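/- Let $d\ge 1$. For $V:\mathbb Z^d\to\mathbb R$ let $H$ be the discrete Schrödinger operator on $\ell_2(\mathbb Z^d)$, $$(Hf)(x)=\sum_{i=1}^d \big(f(x+e_i)+f(x-e_i)\big)+V(x)f(x),$$ with domain $\{f\in\ell_2(\mathbb Z^d): Hf\in\ell_2(\mathbb Z^d)\}$ (all of $\ell_2(\mathbb Z^d)$ if $V$ is bounded). Throughout, $\|x\|=\max_i|x_i|$. For a finite $s\subset\mathbb Z^d$ let $H_s=P_sHP_s^*$ be the restriction of $H$ to $\ell_2(s)$, and for $E\in\mathbb R$ let $G_E[H_s]=(H_s-E)^{-1}$; if $E$ is an eigenvalue of $H_s$ we put $\|G_E[H_s]\|=\infty$. A box is a product of $d$ finite integer intervals. An $L$-rectangle is a box with one side of $L+1$ points and $d-1$ sides of $2L+1$ points. The inner boundary $\partial_{\rm in}s$ is the set of points of $s$ with a nearest neighbour outside $s$. Fix $m>0$, $b\in(0,1)$ and an integer $J\ge1$. * An $L$-rectangle $R$ is $E$-regular if $E$ is not an eigenvalue of $H_R$ and $|G_E[H_R](x,y)|\le e^{-m(L+L^b)}$ for all $x,y\in\partial_{\rm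 in}R$ with $\|x-y\|\ge L$; otherwise it is $E$-singular. * A finite set $B$ is $(E,L)$-resonant if there is $s\subset B$ of the form $s=B_1\setminus B_2$, with $B_1,B_2$ boxes, such that $\|G_E[H_s]\|>\exp\big(\tfrac{mL^b}{16J}\big)$. * A collection of non-empty sets is $n$-sparse in $B$ if it does not contain $n$ pairwise disjoint sets that are subsets of $B$. **Proposition.** For any $d\ge1$, $m>0$, $b\in(0,1)$, $\gamma\in(2-b,\infty)$ and integer $J\ge1$ there exists $L_*=L_*(m,b,\gamma,J,d)$ such that the following holds for every integer $L_0\ge L_*$ and every $V:\mathbb Z^d\to\mathbb R$. Let $L_{k+1}=\lfloor L_k^\gamma\rfloor$ for $k\ge0$, and assume that for every $E\in\mathbb R$ 1. for every $k\ge0$, the $(E,L_k)$-resonant $L_{k+1}$-rectangles are $J$-sparse in any $L_{k+2}$-rectangle, and $2$-sparse in the box $[-L_{k+2},L_{k+2}]^d$; 2. the $E$-singular $L_0$-rectangles are $J$-sparse in any $L_1$-rectangle. Then (a) the spectrum of $H$ is pure point, i.e. the eigenfunctions of $H$ span a dense subspace of $\ell_2(\mathbb Z^d)$; (b) every eigenfunction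 $\psi$ of $H$ satisfies $\sup_{x\in\mathbb Z^d}|\psi(x)|\exp\big(\tfrac m{16}\|x\|\big)<\infty$. -/

import Mathlib

noncomputable section

namespace MSA

/-- The lattice `ℤ^d`. The Mathlib norm on it is the sup norm. -/
abbrev Lattice (d : ℕ) : Type := Fin d → ℤ

/-- The Hilbert space `ℓ₂(ℤ^d)` of complex square-summable functions. -/
abbrev Ell2 (d : ℕ) : Type := lp (fun _ : Lattice d => ℂ) 2

/-- The formal action `f ↦ (x ↦ ∑_{y ∼ x} f y + V x * f x)` on all functions on `ℤ^d`, the sum being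
over the `2 d` nearest neighbours `x ± e_i` of `x`. -/
def formalSchrodinger {d : ℕ} (V : Lattice d → ℝ) : (Lattice d → ℂ) →ₗ[ℂ] (Lattice d → ℂ) where
  toFun f x := ∑ i : Fin d, (f (x + Pi.single i 1) + f (x - Pi.single i 1)) + (V x : ℂ) * f x
  map_add' f g := by
    funext x
    simp only [Pi.add_apply, Finset.sum_add_distrib]
    ring
  map_smul' c f := by
    funext x
    simp only [Pi.smul_apply, smul_eq_mul, RingHom.id_apply, Finset.sum_add_distrib, mul_add,
      Finset.mul_sum]
    ring

/-- The discrete Schrödinger operator with potential `V` on `ℓ₂(ℤ^d)`, with its self-adjoint domain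
`{f ∈ ℓ₂ : H f ∈ ℓ₂}` (all of `ℓ₂` if `V` is bounded). -/
def schrodinger {d : ℕ} (V : Lattice d → ℝ) : Ell2 d →ₗ.[ℂ] Ell2 d where
  domain :=
    { carrier := {f | Memℓp (formalSchrodinger V (f : Lattice d → ℂ)) 2}
      add_mem' := by
        intro f g hf hg
        have h := Memℓp.add hf hg
        rw [← map_add] at h
        exact h
      zero_mem' := by
        change Memℓp (formalSchrodinger V (0 : Lattice d → ℂ)) 2
        rw [map_zero]
        exact zero_memℓp
      smul_mem' := by
        intro c f hf
        have h := Memℓp.const_smul hf c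
        rw [← map_smul] at h
        exact h }
  toFun :=
    { toFun := fun f => ⟨formalSchrodinger V ((f : Ell2 d) : Lattice d → ℂ), f.2⟩
      map_add' := fun f g => Subtype.ext
        (map_add (formalSchrodinger V) ((f : Ell2 d) : Lattice d → ℂ) ((g : Ell2 d) : Lattice d → ℂ))
      map_smul' := fun c f => Subtype.ext
        (map_smul (formalSchrodinger V) c ((f : Ell2 d) : Lattice d → ℂ)) }

/-- `ψ ∈ ℓ₂(ℤ^d)` is an eigenfunction of the partially defined operator `T`. -/
def IsEigenfunction {d : ℕ} (T : Ell2 d →ₗ.[ℂ] Ell2 d) (ψ : Ell2 d) : Prop :=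
  ψ ≠ 0 ∧ ∃ E : ℂ, ∃ h : ψ ∈ T.domain, T ⟨ψ, h⟩ = E • ψ

/-- Pure point spectrum: the eigenfunctions span a dense subspace, that is, the pure point subspace
is all of `ℓ₂(ℤ^d)`. -/
def HasPurePointSpectrum {d : ℕ} (T : Ell2 d →ₗ.[ℂ] Ell2 d) : Prop :=
  (Submodule.span ℂ {ψ : Ell2 d | IsEigenfunction T ψ}).topologicalClosure = ⊤

/-- The restriction `H_s = P_s H P_s^*` to a finite set `s`, as the matrix
`(x, y) ↦ (H δ_y)(x)`, `x, y ∈ s`. -/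
def restriction {d : ℕ} (V : Lattice d → ℝ) (s : Finset (Lattice d)) : Matrix s s ℂ :=
  Matrix.of fun x y => formalSchrodinger V (Pi.single (y : Lattice d) 1) (x : Lattice d)

/-- `E` is not an eigenvalue of `H_s`, so that the resolvent `(H_s - E)⁻¹` exists. -/
def HasResolvent {d : ℕ} (V : Lattice d → ℝ) (E : ℝ) (s : Finset (Lattice d)) : Prop :=
  IsUnit (restriction V s - (E : ℂ) • (1 : Matrix s s ℂ))

/-- The resolvent `G_E[H_s] = (H_s - E)⁻¹` (meaningful under `HasResolvent`). -/
def green {d : ℕ} (V : Lattice d → ℝ) (E : ℝ) (s : Finset (Lattice d)) : Matrix s s ℂ :=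
  (restriction V s - (E : ℂ) • (1 : Matrix s s ℂ))⁻¹

/-- Boxes: products of `d` (finite, possibly empty) integer intervals. -/
def IsBox {d : ℕ} (B : Finset (Lattice d)) : Prop :=
  ∃ a c : Lattice d, B = Finset.Icc a c

/-- Differences of two boxes. -/
def IsBoxDiff {d : ℕ} (s : Finset (Lattice d)) : Prop :=
  ∃ B₁ B₂ : Finset (Lattice d), IsBox B₁ ∧ IsBox B₂ ∧ s = B₁ \ B₂

/-- `L`-rectangles: boxes with one side of `L + 1` points and `d - 1` sides of `2 L + 1` points. -/
def IsRectangle {d : ℕ} (L : ℕ) (R : Finset (Lattice d)) : Prop :=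
  ∃ (a : Lattice d) (i : Fin d),
    R = Finset.Icc a (fun j => a j + if j = i then (L : ℤ) else 2 * (L : ℤ))

/-- The inner boundary: points of `s` with a nearest neighbour outside `s`. -/
def innerBoundary {d : ℕ} (s : Finset (Lattice d)) : Set (Lattice d) :=
  {u | u ∈ s ∧ ∃ i : Fin d, u + Pi.single i 1 ∉ s ∨ u - Pi.single i 1 ∉ s}

/-- `E`-regularity (with mass `m` and exponent `b`) of an `L`-rectangle `R`. -/
def IsRegular {d : ℕ} (V : Lattice d → ℝ) (m b : ℝ) (E : ℝ) (L : ℕ)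
    (R : Finset (Lattice d)) : Prop :=
  HasResolvent V E R ∧
    ∀ x y : R, (x : Lattice d) ∈ innerBoundary R → (y : Lattice d) ∈ innerBoundary R →
      (L : ℝ) ≤ ‖(x : Lattice d) - (y : Lattice d)‖ →
        ‖green V E R x y‖ ≤ Real.exp (-m * ((L : ℝ) + (L : ℝ) ^ b))

/-- `(E, L)`-resonance of a finite set `B`: some difference of boxes `s ⊆ B` has
`‖G_E[H_s]‖ > exp (m L^b / (16 J))` in the `ℓ₂` operator norm, which counts as infinite when `E` is
an eigenvalue of `H_s`. -/
def IsResonant {d : ℕ} (V : Lattice d → ℝ) (m b : ℝ) (J : ℕ) (E : ℝ) (L : ℕ)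
    (B : Finset (Lattice d)) : Prop :=
  ∃ s : Finset (Lattice d), IsBoxDiff s ∧ s ⊆ B ∧
    (¬ HasResolvent V E s ∨
      Real.exp (m * (L : ℝ) ^ b / (16 * (J : ℝ))) <
        ‖Matrix.toEuclideanCLM (n := s) (𝕜 := ℂ) (green V E s)‖)

/-- A collection `S` of finite sets is `J`-sparse in `B` if there are no `J` pairwise disjoint
members of `S` contained in `B`. -/
def IsSparse {d : ℕ} (J : ℕ) (S : Set (Finset (Lattice d))) (B : Finset (Lattice d)) : Prop :=
  ¬ ∃ R : Fin J → Finset (Lattice d),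
    (∀ j, R j ∈ S ∧ R j ⊆ B) ∧ ∀ i j, i ≠ j → Disjoint (R i) (R j)

/-- The `(E, L)`-resonant `L'`-rectangles. -/
def resonantRectangles {d : ℕ} (V : Lattice d → ℝ) (m b : ℝ) (J : ℕ) (E : ℝ) (L L' : ℕ) :
    Set (Finset (Lattice d)) :=
  {R | IsRectangle L' R ∧ IsResonant V m b J E L R}

/-- The `E`-singular `L`-rectangles. -/
def singularRectangles {d : ℕ} (V : Lattice d → ℝ) (m b : ℝ) (E : ℝ) (L : ℕ) :
    Set (Finset (Lattice d)) :=
  {R | IsRectangle L R ∧ ¬ IsRegular V m b E L R}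

/-- The box `[-L, L]^d`. -/
def centredBox (d : ℕ) (L : ℕ) : Finset (Lattice d) :=
  Finset.Icc (fun _ => -(L : ℤ)) (fun _ => (L : ℤ))

/-- The scales `L_0`, `L_{k+1} = ⌊L_k^γ⌋`. -/
def scale (γ : ℝ) (L₀ : ℕ) : ℕ → ℕ
  | 0 => L₀
  | k + 1 => ⌊(scale γ L₀ k : ℝ) ^ γ⌋₊

end MSA

end

namespace MSA

noncomputable section

open Filter Topology ComplexConjugate

variable {d : ℕ}

/-! The proof is a deterministic multi-scale analysis, followed by a finite-volume argument for
completeness that needs no spectral theorem for `H`.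

Green's functions. Cut a non-resonant box into slabs along a coordinate. An `L`-rectangle flush with
the first face of a slab can be left inside the slab only at distance at least `L` from the base
point. If it is regular, the Poisson formula therefore moves forward by at most `L + 2` at the price
`exp (-m (L + L^b))`. All singular rectangles meet a family of fewer than `J` of them, so they block
fewer than `J` short ranges of the coordinate, and each range is jumped over with the a priori bound
`resBound`. This gives decay of the kernel (`norm_greenKernel_le_of_lt`). The surplus `m L^b` pays
for jumps and polynomial factors and still reproduces the surplus at the next scale; this is where
`2 - b < γ` enters. So non-resonant rectangles at the next scale are regular
(`GoodScales.isRegular`), singular ones are resonant, and `J`-sparsity propagates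
(`sparseAtAllScales`).

Solutions. At each scale there are two cases. If a central box is non-resonant, a solution is tiny
near the origin. If it is resonant, `2`-sparsity makes rectangles away from it non-resonant, and the
solution decays at rate `m / 16` on an annulus (`SparseAtAllScales.norm_apply_le_exp`). For a
nonzero eigenfunction the first case can occur at only finitely many scales, and the annuli of the
others cover a neighbourhood of infinity. This proves exponential decay.

Completeness. Let `f` be orthogonal to all eigenfunctions. Expand a cut-off of `f` in an eigenbasis
of `H` on a large central box. Finite-volume eigenfunctions with a non-resonant central box at some
scale `k ≥ K` have small total weight at a fixed `x`, by summing `exp (-m k)`. Those resonant at all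
these scales, and not negligible at `x`, are localized uniformly in the volume
(`SparseAtAllScales.uniform_decay`). By compactness `f` is almost orthogonal to them, since
otherwise a limit point would be an eigenfunction not orthogonal to `f`. Hence `f x = 0`
(`norm_apply_le_of_orthogonal`). -/

/-! ### Finite-volume resolvents and the Poisson formula -/

/-- The resolvent kernel of `H_s`, extended by zero to `ℤ^d × ℤ^d`. -/
def greenKernel (V : Lattice d → ℝ) (E : ℝ) (s : Finset (Lattice d)) (x z : Lattice d) : ℂ :=
  if h : x ∈ s ∧ z ∈ s then green V E s ⟨x, h.1⟩ ⟨z, h.2⟩ else 0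

lemma greenKernel_of_mem (V : Lattice d → ℝ) (E : ℝ) {s : Finset (Lattice d)} (x z : s) :
    greenKernel V E s x z = green V E s x z := by
  simp [greenKernel]

lemma greenKernel_of_notMem_left (V : Lattice d → ℝ) (E : ℝ) {s : Finset (Lattice d)}
    {x : Lattice d} (z : Lattice d) (hx : x ∉ s) : greenKernel V E s x z = 0 := by
  simp [greenKernel, hx]

lemma formalSchrodinger_apply (V : Lattice d → ℝ) (f : Lattice d → ℂ) (x : Lattice d) :
    formalSchrodinger V f x =
      ∑ i : Fin d, (f (x + Pi.single i 1) + f (x - Pi.single i 1)) + (V x : ℂ) * f x := rfl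

lemma formalSchrodinger_single (V : Lattice d → ℝ) (x y : Lattice d) :
    formalSchrodinger V (Pi.single y 1) x =
      ∑ i : Fin d, ((if x + Pi.single i 1 = y then (1 : ℂ) else 0) +
        (if x - Pi.single i 1 = y then (1 : ℂ) else 0)) + (V x : ℂ) * (if x = y then 1 else 0) := by
  simp only [formalSchrodinger_apply, Pi.single_apply]

lemma restriction_symm (V : Lattice d → ℝ) (s : Finset (Lattice d)) :
    (restriction V s).transpose = restriction V s := by
  ext x y
  simp only [restriction, Matrix.transpose_apply, Matrix.of_apply, formalSchrodinger_single]
  obtain ⟨x, hx⟩ := x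
  obtain ⟨y, hy⟩ := y
  have h1 : ∀ i : Fin d, (y + Pi.single i 1 = x) = (x - Pi.single i 1 = y) := fun i =>
    propext ⟨fun h => by rw [← h, add_sub_cancel_right], fun h => by rw [← h, sub_add_cancel]⟩
  have h2 : ∀ i : Fin d, (y - Pi.single i 1 = x) = (x + Pi.single i 1 = y) := fun i =>
    propext ⟨fun h => by rw [← h, sub_add_cancel], fun h => by rw [← h, add_sub_cancel_right]⟩
  simp only [h1, h2]
  congr 1
  · exact Finset.sum_congr rfl fun i _ => add_comm _ _
  · by_cases h : x = y
    · simp [h]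
    · simp [h, Ne.symm h]

lemma restriction_isHermitian (V : Lattice d → ℝ) (s : Finset (Lattice d)) :
    (restriction V s).IsHermitian := by
  unfold Matrix.IsHermitian Matrix.conjTranspose
  rw [restriction_symm]
  ext x y
  simp only [restriction, Matrix.map_apply, Matrix.of_apply, formalSchrodinger_single]
  have h : ∀ (p : Prop) [Decidable p], star (if p then (1 : ℂ) else 0) = if p then 1 else 0 := by
    intro p _
    split_ifs <;> simp
  simp only [star_add, star_sum, star_mul', h]
  simp

lemma green_symm (V : Lattice d → ℝ) (E : ℝ) (s : Finset (Lattice d)) (x z : s) :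
    green V E s x z = green V E s z x := by
  have h : (green V E s).transpose = green V E s := by
    simp [green, Matrix.transpose_nonsing_inv, restriction_symm]
  exact congrFun (congrFun h z) x

lemma greenKernel_symm (V : Lattice d → ℝ) (E : ℝ) (s : Finset (Lattice d)) (x z : Lattice d) :
    greenKernel V E s x z = greenKernel V E s z x := by
  unfold greenKernel
  by_cases h : x ∈ s ∧ z ∈ s
  · rw [dif_pos h, dif_pos h.symm, green_symm]
  · rw [dif_neg h, dif_neg (fun h' => h h'.symm)]

/-- On `s`, the restricted operator acts as the formal one on functions cut off to `s`. -/
lemma restriction_mulVec (V : Lattice d → ℝ) (s : Finset (Lattice d)) (f : Lattice d → ℂ) (x : s) :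
    (restriction V s).mulVec (fun y : s => f y) x =
      formalSchrodinger V ((s : Set (Lattice d)).indicator f) x := by
  have h : (s : Set (Lattice d)).indicator f =
      ∑ y ∈ s, f y • (Pi.single y (1 : ℂ) : Lattice d → ℂ) := by
    funext w
    simp [Finset.sum_apply, Pi.single_apply, Set.indicator_apply]
  rw [h, map_sum, Finset.sum_apply, ← Finset.sum_coe_sort]
  simp [Matrix.mulVec, dotProduct, restriction, mul_comm]

lemma sub_smul_one_mulVec {s : Finset (Lattice d)} (A : Matrix s s ℂ) (E : ℂ) (f : s → ℂ) (x : s) :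
    (A - E • (1 : Matrix s s ℂ)).mulVec f x = A.mulVec f x - E * f x := by
  simp [Matrix.sub_mulVec, Matrix.smul_mulVec]

lemma formalSchrodinger_greenKernel (V : Lattice d → ℝ) {E : ℝ} {s : Finset (Lattice d)}
    (hs : HasResolvent V E s) {x z : Lattice d} (hx : x ∈ s) (hz : z ∈ s) :
    formalSchrodinger V (fun y => greenKernel V E s y z) x =
      E * greenKernel V E s x z + if x = z then 1 else 0 := by
  have hind : (s : Set (Lattice d)).indicator (fun y => greenKernel V E s y z) =
      fun y => greenKernel V E s y z := by
    funext y
    by_cases hy : y ∈ s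
    · simp [hy]
    · simp [hy, greenKernel_of_notMem_left]
  have h1 := restriction_mulVec V s (fun y => greenKernel V E s y z) ⟨x, hx⟩
  rw [hind] at h1
  rw [← h1]
  have h2 := sub_smul_one_mulVec (restriction V s) E (fun y : s => greenKernel V E s y z) ⟨x, hx⟩
  have h3 : (restriction V s - (E : ℂ) • (1 : Matrix s s ℂ)) * green V E s = 1 :=
    Matrix.mul_nonsing_inv _ ((Matrix.isUnit_iff_isUnit_det _).1 hs)
  have h4 : (restriction V s - (E : ℂ) • (1 : Matrix s s ℂ)).mulVec
      (fun y : s => greenKernel V E s y z) ⟨x, hx⟩ = if x = z then 1 else 0 := by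
    have := congrFun (congrFun h3 ⟨x, hx⟩) ⟨z, hz⟩
    rw [Matrix.mul_apply, Matrix.one_apply] at this
    simp only [Subtype.mk.injEq] at this
    rw [← this]
    simp only [Matrix.mulVec, dotProduct]
    refine Finset.sum_congr rfl fun y _ => ?_
    rw [← greenKernel_of_mem V E y ⟨z, hz⟩]
  rw [h4] at h2
  rw [h2]
  ring

/-- The geometric resolvent (Poisson) formula. -/
lemma poisson_formula (V : Lattice d → ℝ) {E : ℝ} {s : Finset (Lattice d)}
    (hs : HasResolvent V E s) {f : Lattice d → ℂ}
    (hf : ∀ y ∈ s, formalSchrodinger V f y = E * f y) {x : Lattice d} (hx : x ∈ s) :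
    f x = -∑ y ∈ s, greenKernel V E s x y *
      formalSchrodinger V ((s : Set (Lattice d))ᶜ.indicator f) y := by
  have hsplit : ∀ y : s, (restriction V s - (E : ℂ) • (1 : Matrix s s ℂ)).mulVec
      (fun y : s => f y) y =
      -formalSchrodinger V ((s : Set (Lattice d))ᶜ.indicator f) y := by
    intro y
    rw [sub_smul_one_mulVec, restriction_mulVec, ← hf y y.2]
    have h : formalSchrodinger V f = formalSchrodinger V ((s : Set (Lattice d)).indicator f) +
        formalSchrodinger V ((s : Set (Lattice d))ᶜ.indicator f) := by
      rw [← map_add, Set.indicator_self_add_compl]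
    rw [h]
    simp
  have h3 : green V E s * (restriction V s - (E : ℂ) • (1 : Matrix s s ℂ)) = 1 :=
    Matrix.nonsing_inv_mul _ ((Matrix.isUnit_iff_isUnit_det _).1 hs)
  have h4 : (green V E s).mulVec ((restriction V s - (E : ℂ) • (1 : Matrix s s ℂ)).mulVec
      (fun y : s => f y)) = fun y : s => f y := by
    rw [Matrix.mulVec_mulVec, h3, Matrix.one_mulVec]
  have h5 := congrFun h4 ⟨x, hx⟩
  simp only [Matrix.mulVec, dotProduct] at h5 hsplit
  rw [← h5, ← Finset.sum_coe_sort s, ← Finset.sum_neg_distrib]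
  refine Finset.sum_congr rfl fun y _ => ?_
  rw [hsplit y, ← greenKernel_of_mem]
  ring

/-- `y'` is a nearest neighbour of `y` in direction `j`. -/
def IsNeighbour (j : Fin d) (y y' : Lattice d) : Prop :=
  y' = y + Pi.single j 1 ∨ y' = y - Pi.single j 1

/-- In the Poisson formula only bonds that leave `s` contribute, and each point has `2 d` bonds. -/
lemma norm_le_of_poisson (V : Lattice d → ℝ) {E : ℝ} {s : Finset (Lattice d)}
    (hs : HasResolvent V E s) {f : Lattice d → ℂ}
    (hf : ∀ y ∈ s, formalSchrodinger V f y = E * f y) {x : Lattice d} (hx : x ∈ s) {C : ℝ}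
    (hC0 : 0 ≤ C)
    (hC : ∀ y ∈ s, ∀ j y', IsNeighbour j y y' → y' ∉ s → ‖greenKernel V E s x y‖ * ‖f y'‖ ≤ C) :
    ‖f x‖ ≤ 2 * d * s.card * C := by
  rw [poisson_formula V hs hf hx, norm_neg]
  have key : ∀ y ∈ s, ‖greenKernel V E s x y *
      formalSchrodinger V ((s : Set (Lattice d))ᶜ.indicator f) y‖ ≤ 2 * d * C := by
    intro y hy
    have hV : ((s : Set (Lattice d))ᶜ.indicator f) y = 0 := by simp [hy]
    have hb : ∀ j y', IsNeighbour j y y' →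
        ‖greenKernel V E s x y‖ * ‖((s : Set (Lattice d))ᶜ.indicator f) y'‖ ≤ C := by
      intro j y' hn
      by_cases h : y' ∈ s
      · simpa [h] using hC0
      · simpa [h] using hC y hy j y' hn h
    rw [formalSchrodinger_apply, hV, mul_zero, add_zero, Finset.mul_sum]
    refine (norm_sum_le _ _).trans ?_
    calc _ ≤ ∑ _j : Fin d, 2 * C := by
          refine Finset.sum_le_sum fun j _ => ?_
          rw [norm_mul]
          have h1 := hb j _ (Or.inl rfl)
          have h2 := hb j _ (Or.inr rfl)
          have h3 := mul_le_mul_of_nonneg_left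
            (norm_add_le (((s : Set (Lattice d))ᶜ.indicator f) (y + Pi.single j 1))
              (((s : Set (Lattice d))ᶜ.indicator f) (y - Pi.single j 1)))
            (norm_nonneg (greenKernel V E s x y))
          linarith
      _ = 2 * d * C := by simp; ring
  refine (norm_sum_le _ _).trans ((Finset.sum_le_sum key).trans ?_)
  simp only [Finset.sum_const, nsmul_eq_mul]
  exact le_of_eq (by ring)

lemma norm_greenKernel_le (V : Lattice d → ℝ) (E : ℝ) (s : Finset (Lattice d)) (x z : Lattice d) :
    ‖greenKernel V E s x z‖ ≤ ‖Matrix.toEuclideanCLM (n := s) (𝕜 := ℂ) (green V E s)‖ := by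
  by_cases h : x ∈ s ∧ z ∈ s
  · obtain ⟨hx, hz⟩ := h
    have h1 : greenKernel V E s x z = (Matrix.toEuclideanCLM (n := s) (𝕜 := ℂ) (green V E s)
        (EuclideanSpace.single ⟨z, hz⟩ 1)) ⟨x, hx⟩ := by
      rw [show greenKernel V E s x z = green V E s ⟨x, hx⟩ ⟨z, hz⟩ from
        greenKernel_of_mem V E ⟨x, hx⟩ ⟨z, hz⟩]
      simp [Matrix.ofLp_toEuclideanCLM]
    rw [h1]
    refine (PiLp.norm_apply_le _ _).trans ((ContinuousLinearMap.le_opNorm _ _).trans ?_)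
    simp
  · simp [greenKernel, h]

lemma IsBox.isBoxDiff (hd : 1 ≤ d) {B : Finset (Lattice d)} (hB : IsBox B) : IsBoxDiff B := by
  -- The interval from `1` to `0` is empty only if there is a coordinate, hence `1 ≤ d`.
  refine ⟨B, ∅, hB, ⟨fun _ => 1, fun _ => 0, ?_⟩, by simp⟩
  symm
  rw [Finset.Icc_eq_empty_iff]
  intro h
  have := h ⟨0, hd⟩
  norm_num at this

lemma IsResonant.mono {V : Lattice d → ℝ} {m b : ℝ} {J : ℕ} {E : ℝ} {L : ℕ}
    {B B' : Finset (Lattice d)} (h : IsResonant V m b J E L B) (hB : B ⊆ B') :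
    IsResonant V m b J E L B' := by
  obtain ⟨s, h1, h2, h3⟩ := h
  exact ⟨s, h1, h2.trans hB, h3⟩

/-- The bound on the resolvents of non-resonant boxes. -/
def resBound (m b : ℝ) (J L : ℕ) : ℝ := Real.exp (m * (L : ℝ) ^ b / (16 * (J : ℝ)))

lemma resolvent_of_not_isResonant (hd : 1 ≤ d) {V : Lattice d → ℝ} {m b : ℝ} {J : ℕ} {E : ℝ} {L : ℕ}
    {B s : Finset (Lattice d)} (h : ¬ IsResonant V m b J E L B) (hs : IsBox s) (hsB : s ⊆ B) :
    HasResolvent V E s ∧ ∀ x z, ‖greenKernel V E s x z‖ ≤ resBound m b J L := by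
  unfold IsResonant at h
  push Not at h
  obtain ⟨h1, h2⟩ := h s (hs.isBoxDiff hd) hsB
  exact ⟨h1, fun x z => (norm_greenKernel_le V E s x z).trans h2⟩

/-! ### The abstract decay recursion and maximal disjoint families -/

/-- A downward recursion for a family of upper bounds: `Bd t C` says that the `t`-th quantity is at
most `C`. Away from `n` exceptional intervals of `W + 1` integers, the quantity decays by
`exp (-α D)` within `D` steps; every other step costs at most a factor `Q`. -/
lemma decay_of_recursion {n : ℕ} (p : Fin n → ℤ) (W D : ℕ) (z t₀ : ℤ) (Bd : ℤ → ℝ → Prop)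
    {η Q α : ℝ} (hη : 0 ≤ η) (hQ : 1 ≤ Q) (hα : 0 ≤ α)
    (hmono : ∀ t C C', Bd t C → C ≤ C' → Bd t C')
    (htriv : ∀ t, t₀ ≤ t → t ≤ z → Bd t η)
    (hjump : ∀ t t' C, 0 ≤ C → t₀ ≤ t → t < t' → t' ≤ z → Bd t' C → Bd t (Q * C))
    (hgood : ∀ t C, 0 ≤ C → t₀ ≤ t → t + D ≤ z → (∀ j, ¬ (p j ≤ t ∧ t ≤ p j + W)) →
      (∀ t', t < t' → t' ≤ t + D → Bd t' C) → Bd t (Real.exp (-(α * D)) * C))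
    {t : ℤ} (ht₀ : t₀ ≤ t) (htz : t ≤ z) :
    Bd t (η * Q ^ n * Real.exp (-(α * ((z : ℝ) - t - D - n * (W + 1))))) := by
  classical
  have hQ0 : 0 ≤ Q := zero_le_one.trans hQ
  let good : ℤ → Prop := fun t => ∀ j, ¬ (p j ≤ t ∧ t ≤ p j + W)
  -- `g t` counts the non-exceptional integers still ahead, each worth a factor `exp (-α)`; `N t`
  -- counts the exceptional intervals not yet passed, each of which may cost one factor `Q`.
  let g : ℤ → ℕ := fun t => ((Finset.Icc t (z - D)).filter good).card
  let N : ℤ → ℕ := fun t => (Finset.univ.filter fun j => t ≤ p j + W).card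
  have main : ∀ k : ℕ, ∀ t, t₀ ≤ t → t ≤ z → (z - t).toNat < k →
      Bd t (η * Q ^ N t * Real.exp (-(α * g t))) := by
    intro k
    induction k with
    | zero => intro t _ _ h; omega
    | succ k ih =>
      intro t h0 h1 h2
      have trivial_case : g t = 0 → Bd t (η * Q ^ N t * Real.exp (-(α * g t))) := by
        intro hg
        refine hmono _ _ _ (htriv t h0 h1) ?_
        rw [hg]
        simpa using le_mul_of_one_le_right hη (one_le_pow₀ hQ)
      rcases Nat.eq_zero_or_pos (g t) with hg | hg
      · exact trivial_case hg
      have htD : t + D ≤ z := by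
        obtain ⟨s, hs⟩ := Finset.card_pos.1 hg
        simp only [Finset.mem_filter, Finset.mem_Icc] at hs
        omega
      by_cases hgt : good t
      · have := hgood t (η * Q ^ N t * Real.exp (-(α * g t) + α * D))
          (by positivity) h0 htD hgt ?_
        · refine hmono _ _ _ this (le_of_eq ?_)
          rw [Real.exp_add, Real.exp_neg (α * D)]
          field_simp
        · intro t' ht' ht'D
          refine hmono _ _ _ (ih t' (by omega) (by omega) (by omega)) ?_
          have hN : N t' ≤ N t := by
            refine Finset.card_le_card fun j hj => ?_
            simp only [Finset.mem_filter, Finset.mem_univ, true_and] at hj ⊢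
            omega
          have hg' : g t ≤ g t' + D := by
            have hsub : (Finset.Icc t (z - D)).filter good ⊆
                (Finset.Icc t' (z - D)).filter good ∪ Finset.Ico t t' := by
              intro s hs
              simp only [Finset.mem_union, Finset.mem_filter, Finset.mem_Icc,
                Finset.mem_Ico] at hs ⊢
              by_cases h : s < t'
              · exact Or.inr ⟨hs.1.1, h⟩
              · exact Or.inl ⟨⟨by omega, hs.1.2⟩, hs.2⟩
            have h3 := (Finset.card_le_card hsub).trans (Finset.card_union_le _ _)
            rw [Int.card_Ico] at h3
            change g t ≤ g t' + _ at h3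
            omega
          have hg'' : (g t : ℝ) ≤ g t' + D := by exact_mod_cast hg'
          have : -(α * g t') ≤ -(α * g t) + α * D := by nlinarith
          gcongr
      -- Jump to the first integer past the interval: the integers skipped are all exceptional, so
      -- `g` loses nothing, and `N` drops by one, which pays for `Q`.
      · have hbad : ∃ j, p j ≤ t ∧ t ≤ p j + W := by
          by_contra h
          push Not at h
          exact hgt fun j hj => absurd hj.2 (not_le.2 (h j hj.1))
        obtain ⟨j, hj1, hj2⟩ := hbad
        have hgle : ∀ t', t' ≤ p j + W + 1 → t ≤ t' → g t ≤ g t' := by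
          intro t' ht' htt'
          refine Finset.card_le_card fun s hs => ?_
          simp only [Finset.mem_filter, Finset.mem_Icc] at hs ⊢
          have := hs.2 j
          exact ⟨⟨by omega, hs.1.2⟩, hs.2⟩
        -- If the jump overshot `z`, no non-exceptional integer would remain, against `0 < g t`.
        have ht'z : p j + W + 1 ≤ z := by
          by_contra h
          have h3 := hgle (z - D + 1) (by omega) (by omega)
          have h4 : g (z - D + 1) = 0 := by
            simp [g]
          omega
        have h5 := hjump t (p j + W + 1) _ (by positivity) h0 (by omega) ht'z
          (ih (p j + W + 1) (by omega) ht'z (by omega))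
        refine hmono _ _ _ h5 ?_
        have hN : N (p j + W + 1) + 1 ≤ N t := by
          refine Finset.card_lt_card ⟨fun j' hj' => ?_, fun h => ?_⟩
          · simp only [Finset.mem_filter, Finset.mem_univ, true_and] at hj' ⊢
            omega
          · have := h (show j ∈ _ by simpa using hj2)
            simp at this
        have hg' : (g t : ℝ) ≤ g (p j + W + 1) := by
          exact_mod_cast hgle _ le_rfl (by omega)
        calc Q * (η * Q ^ N (p j + W + 1) * Real.exp (-(α * g (p j + W + 1))))
            = η * Q ^ (N (p j + W + 1) + 1) * Real.exp (-(α * g (p j + W + 1))) := by ring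
          _ ≤ _ := by gcongr
  refine hmono _ _ _ (main _ t ht₀ htz (Nat.lt_succ_self _)) ?_
  have hN : N t ≤ n := by
    simpa using Finset.card_le_univ (Finset.univ.filter fun j => t ≤ p j + W)
  have hg : (z : ℝ) - t - D - n * (W + 1) ≤ g t := by
    have hsub : Finset.Icc t (z - D) ⊆ (Finset.Icc t (z - D)).filter good ∪
        Finset.univ.biUnion fun j => Finset.Icc (p j) (p j + W) := by
      intro s hs
      by_cases h : good s
      · exact Finset.mem_union_left _ (Finset.mem_filter.2 ⟨hs, h⟩)
      · refine Finset.mem_union_right _ ?_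
        simp only [good, not_forall, not_not] at h
        simpa using h
    have h3 := (Finset.card_le_card hsub).trans (Finset.card_union_le _ _)
    have h4 : (Finset.univ.biUnion fun j => Finset.Icc (p j) (p j + W)).card ≤ n * (W + 1) := by
      refine Finset.card_biUnion_le.trans ?_
      simp only [Int.card_Icc]
      rw [Finset.sum_congr rfl (g := fun _ => W + 1) (fun j _ => by omega)]
      simp
    rw [Int.card_Icc] at h3
    change _ ≤ g t + _ at h3
    have h5 : z - t - D ≤ (g t : ℤ) + (n * (W + 1) : ℕ) := by omega
    have h6 : ((z - t - D : ℤ) : ℝ) ≤ (((g t : ℤ) + (n * (W + 1) : ℕ) : ℤ) : ℝ) := by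
      exact_mod_cast h5
    push_cast at h6
    linarith
  gcongr

/-- A sparse collection has a maximal disjoint subfamily, of fewer than `J` members. -/
lemma IsSparse.exists_maximal {J : ℕ} {S : Set (Finset (Lattice d))} {B : Finset (Lattice d)}
    (h : IsSparse J S B) :
    ∃ n < J, ∃ R : Fin n → Finset (Lattice d), (∀ j, R j ∈ S ∧ R j ⊆ B) ∧
      ∀ R' ∈ S, R' ⊆ B → ∃ j, ¬ Disjoint R' (R j) := by
  classical
  have hex : ∃ n, IsSparse n S B := ⟨J, h⟩
  have hle : Nat.find hex ≤ J := Nat.find_min' hex h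
  obtain ⟨n, hn⟩ : ∃ n, Nat.find hex = n + 1 := by
    refine Nat.exists_eq_succ_of_ne_zero fun h0 => ?_
    have := Nat.find_spec hex
    rw [h0] at this
    exact this ⟨fun j => j.elim0, fun j => j.elim0, fun j => j.elim0⟩
  have h1 := Nat.find_min hex (m := n) (by omega)
  unfold IsSparse at h1
  rw [not_not] at h1
  obtain ⟨R, hR, hdisj⟩ := h1
  refine ⟨n, by omega, R, hR, fun R' hR' hR'B => ?_⟩
  by_contra hcon
  push Not at hcon
  have h2 := Nat.find_spec hex
  rw [hn] at h2
  refine h2 ⟨Fin.cons R' R, fun j => ?_, fun i j => ?_⟩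
  · refine Fin.cases ?_ (fun j => ?_) j
    · exact ⟨hR', hR'B⟩
    · exact hR j
  · refine Fin.cases ?_ (fun i => ?_) i <;> refine Fin.cases ?_ (fun j => ?_) j
    · exact fun h => absurd rfl h
    · exact fun _ => hcon j
    · exact fun _ => (hcon i).symm
    · intro hij
      exact hdisj i j fun h => hij (by rw [h])

lemma IsSparse.mono {J : ℕ} {S S' : Set (Finset (Lattice d))} {B B' : Finset (Lattice d)}
    (h : IsSparse J S B) (hS : S' ⊆ S) (hB : B' ⊆ B) : IsSparse J S' B' := by
  rintro ⟨R, hR, hd⟩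
  exact h ⟨R, fun j => ⟨hS (hR j).1, (hR j).2.trans hB⟩, hd⟩

/-! ### Slabs, flush rectangles and decay of the Green's function of a box -/

lemma mem_box {a c w : Lattice d} : w ∈ Finset.Icc a c ↔ ∀ j, a j ≤ w j ∧ w j ≤ c j := by
  simp only [Finset.mem_Icc, Pi.le_def, forall_and]

lemma IsNeighbour.apply_self {j : Fin d} {y y' : Lattice d} (h : IsNeighbour j y y') :
    y' j = y j + 1 ∨ y' j = y j - 1 := by
  rcases h with rfl | rfl <;> simp

lemma IsNeighbour.apply_ne {j k : Fin d} {y y' : Lattice d} (h : IsNeighbour j y y') (hk : k ≠ j) :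
    y' k = y k := by
  rcases h with rfl | rfl <;> simp [hk]

lemma IsNeighbour.mem_innerBoundary {j : Fin d} {y y' : Lattice d} (h : IsNeighbour j y y')
    {s : Finset (Lattice d)} (hy : y ∈ s) (hout : y' ∉ s) : y ∈ innerBoundary s := by
  rcases h with rfl | rfl
  · exact ⟨hy, j, Or.inl hout⟩
  · exact ⟨hy, j, Or.inr hout⟩

/-- A neighbour outside a box leaves it in the direction in which it was reached. -/
lemma IsNeighbour.exit {j : Fin d} {y y' a c : Lattice d} (h : IsNeighbour j y y')
    (hy : y ∈ Finset.Icc a c) (hy' : y' ∉ Finset.Icc a c) :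
    (y j = c j ∧ y' j = c j + 1) ∨ (y j = a j ∧ y' j = a j - 1) := by
  rw [mem_box] at hy hy'
  have h1 := hy j
  by_contra hcon
  refine hy' fun k => ?_
  by_cases hk : k = j
  · subst hk
    have := h.apply_self
    omega
  · rw [h.apply_ne hk]
    exact hy k

/-- The part of the box `[a, c]` with `i`-th coordinate at least `t`. -/
def slab (a c : Lattice d) (i : Fin d) (t : ℤ) : Finset (Lattice d) :=
  Finset.Icc (Function.update a i t) c

lemma mem_slab {a c : Lattice d} {i : Fin d} {t : ℤ} (ht : a i ≤ t) {w : Lattice d} :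
    w ∈ slab a c i t ↔ w ∈ Finset.Icc a c ∧ t ≤ w i := by
  simp only [slab, mem_box]
  constructor
  · intro h
    have hi : t ≤ w i := by simpa using (h i).1
    refine ⟨fun j => ⟨?_, (h j).2⟩, hi⟩
    by_cases hj : j = i
    · subst hj; omega
    · simpa [hj] using (h j).1
  · rintro ⟨h, h3⟩ j
    refine ⟨?_, (h j).2⟩
    by_cases hj : j = i
    · subst hj; simpa using h3
    · simpa [hj] using (h j).1

lemma slab_subset {a c : Lattice d} {i : Fin d} {t : ℤ} (ht : a i ≤ t) :
    slab a c i t ⊆ Finset.Icc a c := fun _ hw => ((mem_slab ht).1 hw).1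

lemma slab_self (a c : Lattice d) (i : Fin d) : slab a c i (a i) = Finset.Icc a c := by
  simp [slab]

lemma isBox_slab (a c : Lattice d) (i : Fin d) (t : ℤ) : IsBox (slab a c i t) := ⟨_, _, rfl⟩

/-- Cutting a slab: the resolvent kernel of a slab is controlled by that of a thinner one. -/
lemma greenKernel_slab_le (hd : 1 ≤ d) {V : Lattice d → ℝ} {m b : ℝ} {J : ℕ} {E : ℝ} {L : ℕ}
    {a c : Lattice d} (hres : ¬ IsResonant V m b J E L (Finset.Icc a c)) {P : ℝ}
    (hP : 2 * d * (Finset.Icc a c).card ≤ P) {i : Fin d} {t t' : ℤ} (ht : a i ≤ t)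
    (htt' : t < t') {v z : Lattice d} (hv : v ∈ slab a c i t) (hvt : v i < t')
    (hz : z ∈ slab a c i t') {C : ℝ} (hC0 : 0 ≤ C)
    (hC : ∀ w ∈ slab a c i t', w i = t' → ‖greenKernel V E (slab a c i t') w z‖ ≤ C) :
    ‖greenKernel V E (slab a c i t) v z‖ ≤ resBound m b J L * P * C := by
  have ht' : a i ≤ t' := by omega
  obtain ⟨hr, hb⟩ := resolvent_of_not_isResonant hd hres (isBox_slab a c i t) (slab_subset ht)
  obtain ⟨hr', -⟩ := resolvent_of_not_isResonant hd hres (isBox_slab a c i t') (slab_subset ht')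
  have hη : 0 ≤ resBound m b J L := (Real.exp_pos _).le
  -- As `v` lies outside the thinner slab, the kernel with source `v` solves the homogeneous
  -- equation there, so Poisson's formula applies at `z`.
  rw [greenKernel_symm]
  have hf : ∀ y ∈ slab a c i t', formalSchrodinger V (fun y => greenKernel V E (slab a c i t) y v) y
      = E * greenKernel V E (slab a c i t) y v := by
    intro y hy
    rw [mem_slab ht'] at hy
    rw [formalSchrodinger_greenKernel V hr ((mem_slab ht).2 ⟨hy.1, by omega⟩) hv, if_neg, add_zero]
    rintro rfl
    omega
  refine (norm_le_of_poisson V hr' hf hz (C := C * resBound m b J L) (by positivity) ?_).trans ?_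
  · intro y hy j y' hn hy'
    by_cases hy't : y' ∈ slab a c i t
    · refine mul_le_mul ?_ (hb _ _) (norm_nonneg _) hC0
      rw [greenKernel_symm]
      refine hC y hy ?_
      rw [mem_slab ht'] at hy hy'
      rw [mem_slab ht] at hy't
      have h1 : y' i < t' := by
        by_contra h
        exact hy' ⟨hy't.1, by omega⟩
      by_cases hij : i = j
      · subst hij
        have := hn.apply_self
        omega
      · have := hn.apply_ne hij
        omega
    · simp only [greenKernel_of_notMem_left V E v hy't, norm_zero, mul_zero]
      positivity
  · have h1 : ((slab a c i t').card : ℝ) ≤ (Finset.Icc a c).card := by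
      exact_mod_cast Finset.card_le_card (slab_subset ht')
    calc 2 * d * ((slab a c i t').card : ℝ) * (C * resBound m b J L)
        ≤ 2 * d * ((Finset.Icc a c).card : ℝ) * (C * resBound m b J L) := by gcongr
      _ ≤ P * (C * resBound m b J L) := by gcongr
      _ = _ := by ring

lemma natCast_le_norm_sub {L : ℕ} {u v : Lattice d} (j : Fin d) (h : (L : ℤ) ≤ |u j - v j|) :
    (L : ℝ) ≤ ‖u - v‖ := by
  refine le_trans ?_ (norm_le_pi_norm (u - v) j)
  rw [Pi.sub_apply, Int.norm_eq_abs]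
  exact_mod_cast h

/-- In a slab that starts at the `i`-th coordinate of `u`, there is an `L`-rectangle through `u`,
flush with the start of the slab, which can only be left inside the slab at distance `L` from `u`. -/
lemma exists_flush_rectangle {a c : Lattice d} {L : ℕ} (hside : ∀ j, a j + 2 * L ≤ c j) {i : Fin d}
    {u : Lattice d} (hu : u ∈ Finset.Icc a c) (hui : u i + L + 1 ≤ c i) :
    ∃ R, IsRectangle L R ∧ R ⊆ Finset.Icc a c ∧ u ∈ innerBoundary R ∧
      (∀ w ∈ R, u i ≤ w i ∧ w i ≤ u i + L) ∧
      ∀ v ∈ R, ∀ j v', IsNeighbour j v v' → v' ∉ R → v' ∈ slab a c i (u i) →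
        (L : ℝ) ≤ ‖u - v‖ ∧ u i ≤ v' i ∧ v' i ≤ u i + L + 1 := by
  have hub := mem_box.1 hu
  let lo : Lattice d := fun j => if j = i then u i else max (a j) (min (u j - L) (c j - 2 * L))
  let hi : Lattice d := fun j => lo j + if j = i then (L : ℤ) else 2 * (L : ℤ)
  have hlo : ∀ j, (j = i ∧ lo j = u j ∧ hi j = u j + L) ∨
      (j ≠ i ∧ lo j = max (a j) (min (u j - L) (c j - 2 * L)) ∧ hi j = lo j + 2 * L) := by
    intro j
    by_cases hj : j = i
    · subst hj; simp [lo, hi]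
    · simp [lo, hi, hj]
  have hloi : lo i = u i := by simp [lo]
  have hhii : hi i = u i + L := by simp [hi, lo]
  have huR : u ∈ Finset.Icc lo hi := by
    refine mem_box.2 fun j => ?_
    have h1 := hub j
    have h3 := hside j
    have h4 := hlo j
    omega
  refine ⟨Finset.Icc lo hi, ⟨lo, i, rfl⟩, fun w hw => mem_box.2 fun j => ?_, ?_, fun w hw => ?_, ?_⟩
  · have h1 := hub j
    have h3 := hside j
    have h4 := hlo j
    have h5 := mem_box.1 hw j
    rcases h4 with ⟨rfl, h4⟩ | h4 <;> omega
  · refine ⟨huR, i, Or.inr fun h => ?_⟩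
    have := (mem_box.1 h i).1
    simp [hloi] at this
  · have h5 := mem_box.1 hw i
    omega
  · intro v hv j v' hn hv' hv's
    have hex := hn.exit hv hv'
    rw [mem_slab (hub i).1] at hv's
    have h1 := mem_box.1 hv's.1 j
    have h4 := hlo j
    have h5 := hside j
    have h6 := hub j
    have hv1 := mem_box.1 hv i
    refine ⟨natCast_le_norm_sub j ?_, hv's.2, ?_⟩
    · rcases h4 with ⟨rfl, h4⟩ | h4 <;> rw [le_abs] <;> omega
    · by_cases hij : i = j
      · subst hij
        have := hn.apply_self
        omega
      · have := hn.apply_ne hij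
        omega

/-- Decay of the resolvent kernel of a non-resonant box with few singular rectangles. -/
lemma norm_greenKernel_le_of_lt (hd : 1 ≤ d) {V : Lattice d → ℝ} {m b : ℝ} {J : ℕ} {E : ℝ} {L : ℕ}
    (hm : 0 ≤ m) (hJL : J + 2 ≤ 2 * L) {a c : Lattice d} (hside : ∀ j, a j + 2 * L ≤ c j)
    (hres : ¬ IsResonant V m b J E L (Finset.Icc a c))
    (hsp : IsSparse J (singularRectangles V m b E L) (Finset.Icc a c)) {P α : ℝ} (hP1 : 1 ≤ P)
    (hP : 2 * d * (Finset.Icc a c).card ≤ P) (hα : 0 ≤ α)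
    (hαP : Real.exp (-m * ((L : ℝ) + (L : ℝ) ^ b)) * P * (resBound m b J L * P) ≤
      Real.exp (-(α * (L + 2)))) {x z : Lattice d} (hx : x ∈ Finset.Icc a c)
    (hz : z ∈ Finset.Icc a c) {i : Fin d} (hxz : x i < z i) :
    ‖greenKernel V E (Finset.Icc a c) x z‖ ≤
      resBound m b J L * (resBound m b J L * P) ^ J *
        Real.exp (-(α * ((z i : ℝ) - x i - 3 * J * L))) := by
  set η := resBound m b J L with hη
  have hη1 : 1 ≤ η := Real.one_le_exp (by positivity)
  have hη0 : 0 ≤ η := zero_le_one.trans hη1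
  have hQ1 : 1 ≤ η * P := one_le_mul_of_one_le_of_one_le hη1 hP1
  obtain ⟨n, hnJ, R, hR, hmax⟩ := hsp.exists_maximal
  have hRi : ∀ j, ∃ p : ℤ, ∀ w ∈ R j, p ≤ w i ∧ w i ≤ p + 2 * L := by
    intro j
    obtain ⟨⟨a', i', hR'⟩, -⟩ := (hR j).1
    refine ⟨a' i, fun w hw => ?_⟩
    rw [hR', mem_box] at hw
    obtain ⟨h1, h2⟩ := hw i
    refine ⟨h1, h2.trans ?_⟩
    split_ifs <;> omega
  choose p hp using hRi
  -- The recursion controls kernels of shrinking slabs, each only on its own first face. Every step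
  -- moves forward, so no path can return to a singular region.
  let Bd : ℤ → ℝ → Prop := fun t C =>
    ∀ w ∈ slab a c i t, w i = t → ‖greenKernel V E (slab a c i t) w z‖ ≤ C
  have hai : a i ≤ x i := (mem_box.1 hx i).1
  have hzc : z i ≤ c i := (mem_box.1 hz i).2
  have hjump : ∀ t t' C, 0 ≤ C → a i ≤ t → t < t' → t' ≤ z i → Bd t' C → Bd t (η * P * C) := by
    intro t t' C hC0 ht htt' ht'z hC w hw hwt
    exact greenKernel_slab_le hd hres hP ht htt' hw (by omega)
      ((mem_slab (by omega)).2 ⟨hz, ht'z⟩) hC0 hC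
  -- A flush rectangle occupies coordinates `t` to `t + L` and can meet `R j` only if `p j - L ≤ t ≤
  -- p j + 2 L`, hence `W = 3 L`. Its exits reach `t + L + 1`, and the next slab starts one further,
  -- hence `D = L + 2`.
  have hdec := decay_of_recursion (n := n) (fun j => p j - L) (3 * L) (L + 2) (z i) (a i) Bd hη0
    hQ1 hα (fun t C C' h hCC' w hw hwt => (h w hw hwt).trans hCC')
    (fun t ht _ w _ _ =>
      (resolvent_of_not_isResonant hd hres (isBox_slab a c i t) (slab_subset ht)).2 w z) hjump
    (by
      intro t C hC0 ht htz hgood hC u hu hut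
      have hu' := (mem_slab ht).1 hu
      push_cast at htz
      obtain ⟨R', hR', hR'B, huR', hext, hexit⟩ :=
        exists_flush_rectangle hside hu'.1 (i := i) (by omega)
      have hreg : IsRegular V m b E L R' := by
        by_contra hns
        obtain ⟨j, hj⟩ := hmax R' ⟨hR', hns⟩ hR'B
        rw [Finset.not_disjoint_iff] at hj
        obtain ⟨w, hw1, hw2⟩ := hj
        have h1 := hext w hw1
        have h2 := hp j w hw2
        refine hgood j ?_
        push_cast
        omega
      obtain ⟨hr, -⟩ :=
        resolvent_of_not_isResonant hd hres (isBox_slab a c i t) (slab_subset ht)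
      have hR's : R' ⊆ slab a c i t := fun w hw =>
        (mem_slab ht).2 ⟨hR'B hw, by have := hext w hw; omega⟩
      have hf : ∀ y ∈ R', formalSchrodinger V (fun y => greenKernel V E (slab a c i t) y z) y
          = E * greenKernel V E (slab a c i t) y z := by
        intro y hy
        rw [formalSchrodinger_greenKernel V hr (hR's hy) ((mem_slab ht).2 ⟨hz, by omega⟩), if_neg,
          add_zero]
        rintro rfl
        have := hext y hy
        omega
      have h1 := norm_le_of_poisson V hreg.1 hf huR'.1
        (C := Real.exp (-m * ((L : ℝ) + (L : ℝ) ^ b)) * (η * P * C)) (by positivity) (by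
          intro v hv j v' hn hv'
          by_cases hv's : v' ∈ slab a c i t
          · obtain ⟨h1, h2, h3⟩ := hexit v hv j v' hn hv' (by rwa [hut])
            refine mul_le_mul ?_ ?_ (norm_nonneg _) (Real.exp_pos _).le
            · have := hreg.2 ⟨u, huR'.1⟩ ⟨v, hv⟩ huR' (hn.mem_innerBoundary hv hv') h1
              rwa [← greenKernel_of_mem] at this
            -- The exit point is not on the face of the slab; cutting just beyond it returns to a
            -- face, at the cost of one factor `η * P`.
            · exact greenKernel_slab_le hd hres hP ht (t' := v' i + 1) (by omega) hv's (by omega)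
                ((mem_slab (by omega)).2 ⟨hz, by omega⟩) hC0
                (hC (v' i + 1) (by omega) (by push_cast; omega))
          · simp only [greenKernel_of_notMem_left V E z hv's, norm_zero, mul_zero]
            positivity)
      refine h1.trans ?_
      have hcard : (2 * d * R'.card : ℝ) ≤ P := by
        refine le_trans ?_ hP
        have : (R'.card : ℝ) ≤ (Finset.Icc a c).card := by exact_mod_cast Finset.card_le_card hR'B
        gcongr
      calc (2 * d * R'.card : ℝ) * (Real.exp (-m * ((L : ℝ) + (L : ℝ) ^ b)) * (η * P * C))
          ≤ P * (Real.exp (-m * ((L : ℝ) + (L : ℝ) ^ b)) * (η * P * C)) := by gcongr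
        _ = Real.exp (-m * ((L : ℝ) + (L : ℝ) ^ b)) * P * (η * P) * C := by ring
        _ ≤ Real.exp (-(α * (L + 2))) * C := by gcongr
        _ = _ := by push_cast; ring_nf)
    (t := x i + 1) (by omega) (by omega)
  -- A general `x` is not on the first face of the box: one more cut just beyond `x` is needed,
  -- which makes the power `n + 1 ≤ J`.
  have hfin := greenKernel_slab_le hd hres hP (le_refl (a i)) (t' := x i + 1) (by omega)
    (by rw [slab_self]; exact hx) (by omega) ((mem_slab (by omega)).2 ⟨hz, by omega⟩)
    (by positivity) hdec
  rw [slab_self] at hfin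
  refine hfin.trans ?_
  have hnJ' : (n : ℝ) + 1 ≤ J := by exact_mod_cast hnJ
  have hL : (J : ℝ) + 2 ≤ 2 * L := by exact_mod_cast hJL
  -- With `n ≤ J - 1` the total loss is at most `3 J L - 2 L + J + 2`; this is where `J + 2 ≤ 2 L`
  -- is used.
  have hexp : (z i : ℝ) - x i - 3 * J * L ≤
      (z i : ℝ) - (x i + 1 : ℤ) - ((L + 2 : ℕ) : ℝ) - n * (((3 * L : ℕ) : ℝ) + 1) := by
    push_cast
    have : (n : ℝ) * (3 * L + 1) ≤ (J - 1) * (3 * L + 1) := by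
      gcongr; linarith
    nlinarith
  calc η * P * (η * (η * P) ^ n *
        Real.exp (-(α * ((z i : ℝ) - (x i + 1 : ℤ) - ((L + 2 : ℕ) : ℝ) -
          n * (((3 * L : ℕ) : ℝ) + 1)))))
      = η * (η * P) ^ (n + 1) * Real.exp (-(α * ((z i : ℝ) - (x i + 1 : ℤ) - ((L + 2 : ℕ) : ℝ) -
          n * (((3 * L : ℕ) : ℝ) + 1)))) := by ring
    _ ≤ _ := by
      gcongr
      omega

/-- Symmetry of the kernel gives the decay in both directions; for equal coordinates the right-hand
side exceeds the a priori bound. -/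
lemma norm_greenKernel_le_exp (hd : 1 ≤ d) {V : Lattice d → ℝ} {m b : ℝ} {J : ℕ} {E : ℝ} {L : ℕ}
    (hm : 0 ≤ m) (hJL : J + 2 ≤ 2 * L) {a c : Lattice d} (hside : ∀ j, a j + 2 * L ≤ c j)
    (hres : ¬ IsResonant V m b J E L (Finset.Icc a c))
    (hsp : IsSparse J (singularRectangles V m b E L) (Finset.Icc a c)) {P α : ℝ} (hP1 : 1 ≤ P)
    (hP : 2 * d * (Finset.Icc a c).card ≤ P) (hα : 0 ≤ α)
    (hαP : Real.exp (-m * ((L : ℝ) + (L : ℝ) ^ b)) * P * (resBound m b J L * P) ≤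
      Real.exp (-(α * (L + 2)))) {x z : Lattice d} (hx : x ∈ Finset.Icc a c)
    (hz : z ∈ Finset.Icc a c) (i : Fin d) :
    ‖greenKernel V E (Finset.Icc a c) x z‖ ≤
      resBound m b J L * (resBound m b J L * P) ^ J *
        Real.exp (-(α * (|(x i : ℝ) - z i| - 3 * J * L))) := by
  rcases lt_trichotomy (x i) (z i) with h | h | h
  · have h' : (x i : ℝ) < z i := by exact_mod_cast h
    rw [abs_of_neg (by linarith), neg_sub]
    exact norm_greenKernel_le_of_lt hd hm hJL hside hres hsp hP1 hP hα hαP hx hz h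
  · rw [h, sub_self, abs_zero]
    have hη1 : 1 ≤ resBound m b J L := Real.one_le_exp (by positivity)
    have hη0 : 0 ≤ resBound m b J L := zero_le_one.trans hη1
    refine ((resolvent_of_not_isResonant hd hres ⟨a, c, rfl⟩ subset_rfl).2 x z).trans ?_
    rw [mul_assoc]
    refine le_mul_of_one_le_right hη0 (one_le_mul_of_one_le_of_one_le
      (one_le_pow₀ (one_le_mul_of_one_le_of_one_le hη1 hP1)) (Real.one_le_exp ?_))
    rw [zero_sub, mul_neg, neg_neg]
    positivity
  · have h' : (z i : ℝ) < x i := by exact_mod_cast h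
    rw [abs_of_pos (by linarith), greenKernel_symm]
    exact norm_greenKernel_le_of_lt hd hm hJL hside hres hsp hP1 hP hα hαP hz hx h

/-! ### Numerical relations between consecutive scales -/

/-- An upper bound for the number of boundary bonds of boxes with sides of at most `2 L + 1` points.
-/
def bondBound (d L : ℕ) : ℝ := 2 * d * (2 * (L : ℝ) + 1) ^ d

lemma one_le_bondBound (hd : 1 ≤ d) (L : ℕ) : 1 ≤ bondBound d L := by
  have h1 : (1 : ℝ) ≤ d := by exact_mod_cast hd
  have h2 : (1 : ℝ) ≤ (2 * (L : ℝ) + 1) ^ d := one_le_pow₀ (by linarith [Nat.cast_nonneg (α := ℝ) L])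
  unfold bondBound
  nlinarith

lemma card_box_le {a c : Lattice d} {L : ℕ} (h : ∀ j, c j ≤ a j + 2 * L) :
    ((Finset.Icc a c).card : ℝ) ≤ (2 * (L : ℝ) + 1) ^ d := by
  have h1 : (Finset.Icc a c).card ≤ (2 * L + 1) ^ d := by
    rw [Pi.card_Icc]
    refine (Finset.prod_le_pow_card _ _ (2 * L + 1) fun j _ => ?_).trans (by simp)
    rw [Int.card_Icc]
    have := h j
    omega
  calc ((Finset.Icc a c).card : ℝ) ≤ (((2 * L + 1) ^ d : ℕ) : ℝ) := by exact_mod_cast h1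
    _ = _ := by push_cast; ring

lemma two_mul_card_box_le {a c : Lattice d} {L : ℕ} (h : ∀ j, c j ≤ a j + 2 * L) :
    2 * d * ((Finset.Icc a c).card : ℝ) ≤ bondBound d L := by
  have := card_box_le h
  unfold bondBound
  gcongr

/-- The numerical requirements on two consecutive scales `L`, `L'`. -/
structure GoodScales (d : ℕ) (m b : ℝ) (J L L' : ℕ) : Prop where
  le_two_mul : J + 2 ≤ 2 * L
  mul_le : 1000 * (J + 1) * L ≤ L'
  exists_rate : ∃ α, m ≤ α ∧
    Real.exp (-m * ((L : ℝ) + (L : ℝ) ^ b)) * bondBound d L' *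
      (resBound m b J L * bondBound d L') ≤ Real.exp (-(α * (L + 2))) ∧
    resBound m b J L * (resBound m b J L * bondBound d L') ^ J *
      Real.exp (-(α * ((L' : ℝ) - 3 * J * L))) ≤ Real.exp (-m * ((L' : ℝ) + (L' : ℝ) ^ b)) ∧
    resBound m b J L * (resBound m b J L * bondBound d L') ^ J * bondBound d L' ≤ Real.exp (m * L)

lemma eventually_mul_rpow_le (C : ℝ) {s r : ℝ} (h : s < r) :
    ∀ᶠ x : ℝ in atTop, C * x ^ s ≤ x ^ r := by
  have h1 : Tendsto (fun x : ℝ => x ^ (r - s)) atTop atTop := tendsto_rpow_atTop (by linarith)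
  filter_upwards [h1.eventually_ge_atTop C, eventually_gt_atTop 0] with x hx hx0
  calc C * x ^ s ≤ x ^ (r - s) * x ^ s := by gcongr
    _ = x ^ r := by rw [← Real.rpow_add hx0]; congr 1; ring

/-- The resolvent bounds and polynomial factors cost only a fraction of `m L^b`, so the rate per
step exceeds `m` by at least `(m / 4) L^(b - 1)`. Over the length `L'` this surplus must pay for `m
L'^b` and for the lost length of order `J L`; `hpow1` and `hpow2` say that it does. -/
lemma goodScales_of_bounds (hd : 1 ≤ d) {m b : ℝ} {J L L' : ℕ} (hm : 0 < m) (hb1 : b < 1)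
    (hJ : 1 ≤ J) (h1 : J + 2 ≤ 2 * L) (h2 : 1000 * (J + 1) * L ≤ L') (hL1 : 16 ≤ (L : ℝ) ^ b)
    (hlog : (16 * J + 32) * Real.log (bondBound d L') ≤ m * (L : ℝ) ^ b)
    (hpow1 : 16 * (L' : ℝ) ^ b ≤ (L : ℝ) ^ (b - 1) * L')
    (hpow2 : 16 * ((3 * J + 1) * (L : ℝ)) ≤ (L : ℝ) ^ (b - 1) * L') :
    GoodScales d m b J L L' := by
  have hP1 := one_le_bondBound hd L'
  have hP0 : 0 < bondBound d L' := by linarith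
  set p := Real.log (bondBound d L') with hp
  have hp0 : 0 ≤ p := Real.log_nonneg hP1
  have hPexp : bondBound d L' = Real.exp p := (Real.exp_log hP0).symm
  have hJ' : (1 : ℝ) ≤ J := by exact_mod_cast hJ
  have hL2 : (2 : ℝ) ≤ L := by
    have : 2 ≤ L := by omega
    exact_mod_cast this
  set l := (L : ℝ) ^ b with hl
  have hlL : l ≤ L := by
    calc l ≤ (L : ℝ) ^ (1 : ℝ) := Real.rpow_le_rpow_of_exponent_le (by linarith) hb1.le
      _ = L := Real.rpow_one _
  have hl' : (L : ℝ) ^ (b - 1) = l / L := by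
    rw [Real.rpow_sub (by linarith), Real.rpow_one]
  rw [hl'] at hpow1 hpow2
  set t := m * l / (16 * J) with ht
  have hJt : J * t = m * l / 16 := by rw [ht]; field_simp
  have hml : 0 < m * l := by positivity
  have ht0 : 0 ≤ t := by positivity
  have htle : t ≤ m * l / 16 := by nlinarith
  have hJp : J * p ≤ m * l / 16 := by nlinarith
  have h2p : 2 * p ≤ m * l / 16 := by nlinarith
  have hη : resBound m b J L = Real.exp t := rfl
  have hmain : Real.exp t * (Real.exp t * Real.exp p) ^ J = Real.exp (t + J * t + J * p) := by
    rw [← Real.exp_add, ← Real.exp_nat_mul, ← Real.exp_add]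
    congr 1; ring
  -- The rate that turns the one-step condition into an equality.
  refine ⟨h1, h2, (m * (L + l) - t - 2 * p) / (L + 2), ?_, ?_, ?_, ?_⟩
  · rw [le_div_iff₀ (by linarith)]
    nlinarith
  · rw [hη, hPexp, ← Real.exp_add, ← Real.exp_add, ← Real.exp_add,
      div_mul_cancel₀ _ (by linarith)]
    exact Real.exp_le_exp.2 (by linarith)
  · rw [hη, hPexp, hmain, ← Real.exp_add]
    refine Real.exp_le_exp.2 ?_
    have hα : m + m / 4 * (l / L) ≤ (m * (L + l) - t - 2 * p) / (L + 2) := by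
      rw [le_div_iff₀ (by linarith)]
      have : l / L * (L + 2) ≤ 2 * l := by
        rw [div_mul_eq_mul_div, div_le_iff₀ (by linarith)]
        nlinarith
      nlinarith
    have h2' : 1000 * ((J : ℝ) + 1) * L ≤ L' := by exact_mod_cast h2
    have hL'J : 0 ≤ (L' : ℝ) / 2 - 3 * J * L := by nlinarith
    have hlL0 : 0 ≤ l / L := by positivity
    have h3 : (m + m / 4 * (l / L)) * ((L' : ℝ) - 3 * J * L) ≤
        (m * (L + l) - t - 2 * p) / (L + 2) * ((L' : ℝ) - 3 * J * L) := by
      refine mul_le_mul_of_nonneg_right hα ?_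
      linarith [Nat.cast_nonneg (α := ℝ) L']
    have h4 : m / 8 * (l / L * L') ≤ m / 4 * (l / L) * ((L' : ℝ) - 3 * J * L) := by
      have : 0 ≤ m / 4 * (l / L) * ((L' : ℝ) / 2 - 3 * J * L) := by positivity
      linarith
    have h5 : m * (2 * (L' : ℝ) ^ b + 2 * ((3 * J + 1) * L)) ≤ m * (2 * (l / L * L') / 8) := by
      refine mul_le_mul_of_nonneg_left ?_ hm.le
      linarith
    have h6 : m * l ≤ m * L := by gcongr
    have h7 : 0 ≤ m * (L' : ℝ) ^ b := by positivity
    have h8 : m * (L' : ℝ) ^ b + m * ((3 * J + 1) * L) ≤ m / 8 * (l / L * L') := by linarith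
    linarith
  · rw [hη, hPexp, hmain, ← Real.exp_add]
    refine Real.exp_le_exp.2 ?_
    have h6 : m * l ≤ m * L := by gcongr
    linarith

/-- With `L'` of order `L^γ`, the surplus `L^(b - 1 + γ)` beats `L'^b`, of order `L^(γ b)`, because
`1 < γ`, and beats `L` because `2 - b < γ`. The logarithm of the polynomial factor is below `L^b`,
by comparison with `L^(b / 2)`. -/
lemma eventually_goodScales (hd : 1 ≤ d) {m b γ : ℝ} {J : ℕ} (hm : 0 < m) (hb0 : 0 < b)
    (hb1 : b < 1) (hγ : 2 - b < γ) (hJ : 1 ≤ J) :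
    ∀ᶠ L : ℕ in atTop, GoodScales d m b J L ⌊(L : ℝ) ^ γ⌋₊ := by
  have hγ1 : 1 < γ := by linarith
  have hd' : (1 : ℝ) ≤ d := by exact_mod_cast hd
  let c : ℝ := 2 * d * 3 ^ d
  have hreal : ∀ᶠ x : ℝ in atTop, 1 ≤ x ∧ (J : ℝ) + 2 ≤ 2 * x ∧ 2000 * ((J : ℝ) + 1) * x ^ (1 : ℝ) ≤
      x ^ γ ∧ 16 * x ^ (0 : ℝ) ≤ x ^ b ∧
      (2 * ((16 * J + 32) / m * Real.log c)) * x ^ (0 : ℝ) ≤ x ^ b ∧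
      (2 * ((16 * J + 32) / m * (γ * d * (2 / b)))) * x ^ (b / 2) ≤ x ^ b ∧
      32 * x ^ (γ * b) ≤ x ^ (b - 1 + γ) ∧
      (32 * (3 * J + 1)) * x ^ (1 : ℝ) ≤ x ^ (b - 1 + γ) := by
    filter_upwards [eventually_ge_atTop 1, eventually_ge_atTop (((J : ℝ) + 2) / 2),
      eventually_mul_rpow_le _ hγ1, eventually_mul_rpow_le _ hb0, eventually_mul_rpow_le _ hb0,
      eventually_mul_rpow_le _ (show b / 2 < b by linarith),
      eventually_mul_rpow_le _ (show γ * b < b - 1 + γ by nlinarith),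
      eventually_mul_rpow_le _ (show 1 < b - 1 + γ by linarith)] with x h1 h2 h3 h4 h5 h6 h7 h8
    exact ⟨h1, by linarith, h3, h4, h5, h6, h7, h8⟩
  filter_upwards [tendsto_natCast_atTop_atTop.eventually hreal] with L
    ⟨h1, h2, h3, h4, h5, h6, h7, h8⟩
  rw [Real.rpow_zero, mul_one] at h4 h5
  rw [Real.rpow_one] at h3 h8
  have hL0 : (0 : ℝ) < L := by linarith
  have hJ' : (1 : ℝ) ≤ J := by exact_mod_cast hJ
  have hLγ2 : 2 ≤ (L : ℝ) ^ γ := by nlinarith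
  have hfl : (⌊(L : ℝ) ^ γ⌋₊ : ℝ) ≤ (L : ℝ) ^ γ := Nat.floor_le (by positivity)
  have hfl2 : (L : ℝ) ^ γ / 2 ≤ (⌊(L : ℝ) ^ γ⌋₊ : ℝ) := by
    have := (Nat.lt_floor_add_one ((L : ℝ) ^ γ)).le
    linarith
  set L' := ⌊(L : ℝ) ^ γ⌋₊ with hL'
  have hmulpow : (L : ℝ) ^ (b - 1 + γ) = (L : ℝ) ^ (b - 1) * (L : ℝ) ^ γ := Real.rpow_add hL0 _ _
  have hhalf : (L : ℝ) ^ (b - 1 + γ) / 2 ≤ (L : ℝ) ^ (b - 1) * L' := by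
    rw [hmulpow, mul_div_assoc]
    gcongr
  refine goodScales_of_bounds hd hm hb1 hJ (by exact_mod_cast h2) ?_ h4 ?_ ?_ ?_
  · have : 1000 * ((J : ℝ) + 1) * L ≤ L' := by linarith
    exact_mod_cast this
  · have hP : bondBound d L' ≤ c * (L : ℝ) ^ (γ * d) := by
      unfold bondBound
      have : (2 * (L' : ℝ) + 1) ≤ 3 * (L : ℝ) ^ γ := by linarith
      calc 2 * d * (2 * (L' : ℝ) + 1) ^ d ≤ 2 * d * (3 * (L : ℝ) ^ γ) ^ d := by gcongr
        _ = c * (L : ℝ) ^ (γ * d) := by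
          rw [mul_pow, Real.rpow_mul hL0.le, Real.rpow_natCast]
          simp only [c]; ring
    have hc0 : 0 < c := by positivity
    have hlogP : Real.log (bondBound d L') ≤
        Real.log c + γ * d * (2 / b) * (L : ℝ) ^ (b / 2) := by
      refine (Real.log_le_log (by linarith [one_le_bondBound hd L']) hP).trans ?_
      rw [Real.log_mul hc0.ne' (by positivity), Real.log_rpow hL0]
      have := Real.log_le_rpow_div hL0.le (show 0 < b / 2 by linarith)
      have h9 : (L : ℝ) ^ (b / 2) / (b / 2) = 2 / b * (L : ℝ) ^ (b / 2) := by
        field_simp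
      rw [h9] at this
      have : γ * d * Real.log L ≤ γ * d * (2 / b * (L : ℝ) ^ (b / 2)) := by gcongr
      linarith
    calc (16 * (J : ℝ) + 32) * Real.log (bondBound d L')
        ≤ (16 * (J : ℝ) + 32) * (Real.log c + γ * d * (2 / b) * (L : ℝ) ^ (b / 2)) := by gcongr
      _ = m / 2 * ((2 * ((16 * J + 32) / m * Real.log c)) +
          (2 * ((16 * J + 32) / m * (γ * d * (2 / b)))) * (L : ℝ) ^ (b / 2)) := by
        field_simp
      _ ≤ m / 2 * ((L : ℝ) ^ b + (L : ℝ) ^ b) := by gcongr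
      _ = m * (L : ℝ) ^ b := by ring
  · have : (L' : ℝ) ^ b ≤ (L : ℝ) ^ (γ * b) := by
      rw [Real.rpow_mul hL0.le]
      gcongr
    linarith
  · linarith

/-! ### From one scale to the next -/

namespace GoodScales

variable {m b : ℝ} {J L L' : ℕ}

lemma le (h : GoodScales d m b J L L') : L ≤ L' := by
  have := h.mul_le
  nlinarith

/-- Exponential decay of the resolvent kernel of non-resonant boxes at the scale `L'`. -/
lemma norm_greenKernel_mul_le (hg : GoodScales d m b J L L') (hd : 1 ≤ d) (hm : 0 ≤ m)
    {V : Lattice d → ℝ} {E : ℝ} {a c : Lattice d} (hside : ∀ j, a j + 2 * L ≤ c j)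
    (hside' : ∀ j, c j ≤ a j + 2 * L') (hres : ¬ IsResonant V m b J E L (Finset.Icc a c))
    (hsp : IsSparse J (singularRectangles V m b E L) (Finset.Icc a c)) {x z : Lattice d}
    (hx : x ∈ Finset.Icc a c) (hz : z ∈ Finset.Icc a c) (i : Fin d) :
    ‖greenKernel V E (Finset.Icc a c) x z‖ * bondBound d L' ≤
      Real.exp (-(m * (|(x i : ℝ) - z i| - (3 * J + 1) * L))) := by
  obtain ⟨α, hα, h1, -, h2⟩ := hg.exists_rate
  have hP1 := one_le_bondBound hd L'
  set P := bondBound d L' with hP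
  have hη1 : 1 ≤ resBound m b J L := Real.one_le_exp (by positivity)
  set η := resBound m b J L with hη
  have hη0 : 0 ≤ η := zero_le_one.trans hη1
  -- The prefactors are at most `exp (m L)`, which turns the loss `3 J L` into `(3 J + 1) L`.
  have hgoal : Real.exp (-(m * (|(x i : ℝ) - z i| - (3 * J + 1) * L))) =
      Real.exp (m * L) * Real.exp (-(m * (|(x i : ℝ) - z i| - 3 * J * L))) := by
    rw [← Real.exp_add]; congr 1; ring
  rw [hgoal]
  have key : ‖greenKernel V E (Finset.Icc a c) x z‖ ≤ η * (η * P) ^ J *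
      Real.exp (-(m * (|(x i : ℝ) - z i| - 3 * J * L))) := by
    -- Lowering the rate from `α` to `m` is harmless only beyond the distance `3 J L`; below it the
    -- a priori bound suffices.
    rcases le_total (3 * (J : ℝ) * L) |(x i : ℝ) - z i| with hle | hle
    · refine (norm_greenKernel_le_exp hd hm hg.le_two_mul hside hres hsp hP1
        (two_mul_card_box_le hside') (hm.trans hα) h1 hx hz i).trans ?_
      gcongr
    · refine ((resolvent_of_not_isResonant hd hres ⟨a, c, rfl⟩ subset_rfl).2 x z).trans ?_
      rw [mul_assoc]
      refine le_mul_of_one_le_right hη0 (one_le_mul_of_one_le_of_one_le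
        (one_le_pow₀ (one_le_mul_of_one_le_of_one_le hη1 hP1)) (Real.one_le_exp ?_))
      nlinarith
  calc _ ≤ η * (η * P) ^ J * Real.exp (-(m * (|(x i : ℝ) - z i| - 3 * J * L))) * P := by gcongr
    _ = η * (η * P) ^ J * P * Real.exp (-(m * (|(x i : ℝ) - z i| - 3 * J * L))) := by ring
    _ ≤ _ := by gcongr

/-- A sup-norm distance of at least `L'` is attained in some coordinate, and decay along that
coordinate suffices. The bound holds at all points of the rectangle, not only on its boundary. -/
lemma isRegular (hg : GoodScales d m b J L L') (hd : 1 ≤ d) (hm : 0 ≤ m)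
    {V : Lattice d → ℝ} {E : ℝ} {R : Finset (Lattice d)} (hR : IsRectangle L' R)
    (hres : ¬ IsResonant V m b J E L R)
    (hsp : IsSparse J (singularRectangles V m b E L) R) : IsRegular V m b E L' R := by
  obtain ⟨a, i₀, rfl⟩ := hR
  refine ⟨(resolvent_of_not_isResonant hd hres ⟨_, _, rfl⟩ subset_rfl).1, ?_⟩
  intro x z _ _ hxz
  obtain ⟨α, hα, h1, h2, -⟩ := hg.exists_rate
  have hP1 := one_le_bondBound hd L'
  have hmul := hg.mul_le
  have hlast : ∃ i : Fin d, (L' : ℝ) ≤ |((x : Lattice d) i : ℝ) - (z : Lattice d) i| := by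
    by_contra hcon
    push Not at hcon
    have : ‖(x : Lattice d) - (z : Lattice d)‖ < L' := by
      refine (pi_norm_lt_iff ((abs_nonneg _).trans_lt (hcon i₀))).2 fun i => ?_
      rw [Pi.sub_apply, Int.norm_eq_abs]
      push_cast
      exact hcon i
    linarith
  obtain ⟨i, hi⟩ := hlast
  rw [← greenKernel_of_mem]
  refine (norm_greenKernel_le_exp hd hm hg.le_two_mul (fun j => ?_) hres hsp hP1
        (two_mul_card_box_le fun j => ?_) (hm.trans hα) h1 x.2 z.2 i).trans (le_trans ?_ h2)
  · have : 2 * L ≤ L' := by nlinarith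
    split_ifs <;> omega
  · split_ifs <;> omega
  · have : 0 ≤ α := hm.trans hα
    have hη : 0 ≤ resBound m b J L := (Real.exp_pos _).le
    have hP0 : 0 ≤ bondBound d L' := by linarith
    gcongr

end GoodScales

/-- The assumptions of the multi-scale analysis at the energy `E`, for the sequence of scales `ℓ`,
with the sparsity of singular rectangles at all scales. -/
structure SparseAtAllScales (V : Lattice d → ℝ) (m b : ℝ) (J : ℕ) (E : ℝ) (ℓ : ℕ → ℕ) : Prop where
  scales : ∀ k, GoodScales d m b J (ℓ k) (ℓ (k + 1))
  singular : ∀ k R, IsRectangle (ℓ (k + 1)) R →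
    IsSparse J (singularRectangles V m b E (ℓ k)) R
  resonant : ∀ k, IsSparse 2 (resonantRectangles V m b J E (ℓ k) (ℓ (k + 1)))
    (centredBox d (ℓ (k + 2)))

/-- Multi-scale induction: sparsity of singular rectangles passes from each scale to the next. -/
lemma sparseAtAllScales (hd : 1 ≤ d) {V : Lattice d → ℝ} {m b : ℝ} {J : ℕ} {E : ℝ} {ℓ : ℕ → ℕ}
    (hm : 0 ≤ m) (hscales : ∀ k, GoodScales d m b J (ℓ k) (ℓ (k + 1)))
    (hres : ∀ k R, IsRectangle (ℓ (k + 2)) R →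
      IsSparse J (resonantRectangles V m b J E (ℓ k) (ℓ (k + 1))) R)
    (hres2 : ∀ k, IsSparse 2 (resonantRectangles V m b J E (ℓ k) (ℓ (k + 1)))
      (centredBox d (ℓ (k + 2))))
    (hsing : ∀ R, IsRectangle (ℓ 1) R → IsSparse J (singularRectangles V m b E (ℓ 0)) R) :
    SparseAtAllScales V m b J E ℓ := by
  refine ⟨hscales, fun k => ?_, hres2⟩
  induction k with
  | zero => exact hsing
  | succ k ih =>
    intro R hR
    -- A singular rectangle must be resonant: otherwise the sparsity of the smaller singular
    -- rectangles inside it would make it regular.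
    refine (hres k R hR).mono (fun R' hR' => ⟨hR'.1, ?_⟩) subset_rfl
    by_contra h
    exact hR'.2 ((hscales k).isRegular hd hm hR'.1 h (ih R' hR'.1))

/-! ### Solutions around non-resonant and resonant central boxes -/

lemma mem_centredBox {L : ℕ} {x : Lattice d} : x ∈ centredBox d L ↔ ∀ j, |x j| ≤ L := by
  simp only [centredBox, mem_box, abs_le]

/-- Solutions are small deep inside non-resonant boxes. -/
lemma GoodScales.norm_apply_le {m b : ℝ} {J L L' : ℕ} (hg : GoodScales d m b J L L') (hd : 1 ≤ d)
    (hm : 0 ≤ m) {V : Lattice d → ℝ} {E : ℝ} {a c : Lattice d} (hside : ∀ j, a j + 2 * L ≤ c j)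
    (hside' : ∀ j, c j ≤ a j + 2 * L') (hres : ¬ IsResonant V m b J E L (Finset.Icc a c))
    (hsp : IsSparse J (singularRectangles V m b E L) (Finset.Icc a c)) {f : Lattice d → ℂ}
    (hf : ∀ y ∈ Finset.Icc a c, formalSchrodinger V f y = E * f y) {x : Lattice d} {δ : ℕ}
    (hx : ∀ j, a j + δ ≤ x j ∧ x j + δ ≤ c j) {M : ℝ} (hM0 : 0 ≤ M)
    (hM : ∀ y, (∀ j, a j - 1 ≤ y j ∧ y j ≤ c j + 1) → ‖f y‖ ≤ M) :
    ‖f x‖ ≤ Real.exp (-(m * (δ - (3 * J + 1) * L))) * M := by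
  have hxB : x ∈ Finset.Icc a c := mem_box.2 fun j => by have := hx j; omega
  have hP1 := one_le_bondBound hd L'
  have hP0 : 0 < bondBound d L' := by linarith
  have h1 := norm_le_of_poisson V (resolvent_of_not_isResonant hd hres ⟨a, c, rfl⟩ subset_rfl).1 hf
    hxB (C := Real.exp (-(m * (δ - (3 * J + 1) * L))) / bondBound d L' * M) (by positivity) (by
      intro y hy j y' hn hy'
      have hex := hn.exit hy hy'
      have hyb := mem_box.1 hy
      refine mul_le_mul ?_ (hM y' fun k => ?_) (norm_nonneg _) (by positivity)
      · rw [le_div_iff₀ hP0]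
        refine (hg.norm_greenKernel_mul_le hd hm hside hside' hres hsp hxB hy j).trans ?_
        have h2 : (δ : ℤ) ≤ |x j - y j| := by
          have := hx j
          rw [le_abs]
          omega
        have h3 : (δ : ℝ) ≤ |(x j : ℝ) - y j| := by exact_mod_cast h2
        gcongr
      · have h2 := hyb k
        by_cases hk : k = j
        · subst hk; have := hn.apply_self; omega
        · rw [hn.apply_ne hk]; omega)
  refine h1.trans ?_
  have h2 := two_mul_card_box_le (d := d) hside'
  calc 2 * d * ((Finset.Icc a c).card : ℝ) *
        (Real.exp (-(m * (δ - (3 * J + 1) * L))) / bondBound d L' * M)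
      ≤ bondBound d L' * (Real.exp (-(m * (δ - (3 * J + 1) * L))) / bondBound d L' * M) := by gcongr
    _ = _ := by field_simp

/-- Iterates a local bound that gains `q` from the maximum over radius `D`; after `n` steps the
chain has stayed within `n * D` of its start. -/
lemma norm_apply_le_pow {f : Lattice d → ℂ} {D : ℕ} {q M : ℝ} (hq : 0 ≤ q) (hM : 0 ≤ M) (n : ℕ)
    {y : Lattice d}
    (hstep : ∀ y' : Lattice d, (∀ j, |y' j - y j| ≤ n * D) → ∀ M', 0 ≤ M' →
      (∀ y'' : Lattice d, (∀ j, |y'' j - y' j| ≤ D) → ‖f y''‖ ≤ M') → ‖f y'‖ ≤ q * M')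
    (hf : ∀ y' : Lattice d, (∀ j, |y' j - y j| ≤ n * D) → ‖f y'‖ ≤ M) : ‖f y‖ ≤ q ^ n * M := by
  induction n generalizing y with
  | zero => simpa using hf y (by simp)
  | succ n ih =>
    have hsub : ∀ y' : Lattice d, (∀ j, |y' j - y j| ≤ D) → ∀ y'' : Lattice d, (∀ j, |y'' j - y' j| ≤ n * D) →
        ∀ j, |y'' j - y j| ≤ (n + 1 : ℕ) * D := by
      intro y' hy' y'' hy'' j
      have h1 := hy' j
      have h2 := hy'' j
      have h3 := abs_add_le (y'' j - y' j) (y' j - y j)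
      rw [sub_add_sub_cancel] at h3
      push_cast
      linarith
    rw [pow_succ', mul_assoc]
    refine hstep y (fun j => ?_) _ (by positivity) fun y' hy' => ?_
    · rw [sub_self, abs_zero]; positivity
    · exact ih (fun y'' hy'' => hstep y'' (hsub y' hy' y'' hy''))
        (fun y'' hy'' => hf y'' (hsub y' hy' y'' hy''))

namespace SparseAtAllScales

variable {V : Lattice d → ℝ} {m b : ℝ} {J : ℕ} {E : ℝ} {ℓ : ℕ → ℕ}

lemma isSparse_centredBox (h : SparseAtAllScales V m b J E ℓ) (hd : 1 ≤ d) (k : ℕ) :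
    IsSparse J (singularRectangles V m b E (ℓ k)) (centredBox d (ℓ (k + 1) / 8)) := by
  refine (h.singular k _ ⟨fun j => -((ℓ (k + 1) / 8 : ℕ) : ℤ), ⟨0, hd⟩, rfl⟩).mono subset_rfl ?_
  intro x hx
  rw [mem_centredBox] at hx
  refine mem_box.2 fun j => ?_
  have := abs_le.1 (hx j)
  refine ⟨this.1, ?_⟩
  beta_reduce
  split_ifs <;> omega

/-- If the central box is non-resonant, then solutions are small near its centre. -/
lemma norm_apply_le_of_not_isResonant (h : SparseAtAllScales V m b J E ℓ) (hd : 1 ≤ d)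
    (hm : 0 ≤ m) {k : ℕ} (hres : ¬ IsResonant V m b J E (ℓ k) (centredBox d (ℓ (k + 1) / 8)))
    {f : Lattice d → ℂ}
    (hf : ∀ y ∈ centredBox d (ℓ (k + 1)), formalSchrodinger V f y = E * f y) {x : Lattice d}
    (hx : ∀ j, 32 * |x j| ≤ ℓ (k + 1)) {M : ℝ} (hM0 : 0 ≤ M)
    (hM : ∀ y ∈ centredBox d (ℓ (k + 1)), ‖f y‖ ≤ M) :
    ‖f x‖ ≤ Real.exp (-(m * ℓ k)) * M := by
  have hg := h.scales k
  have hmul := hg.mul_le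
  have h2 := hg.le_two_mul
  set L := ℓ k
  set L' := ℓ (k + 1)
  have hLL' : 1000 * L + 1000 * (J * L) ≤ L' := by linarith
  refine (hg.norm_apply_le hd hm (a := fun _ => -((L' / 8 : ℕ) : ℤ))
    (c := fun _ => ((L' / 8 : ℕ) : ℤ)) (δ := L' / 16) (fun j => by omega) (fun j => by omega) hres
    (h.isSparse_centredBox hd k) (fun y hy => hf y ?_) (fun j => ?_) hM0 (fun y hy => hM y ?_)).trans
    ?_
  · refine mem_centredBox.2 fun j => ?_
    have := mem_box.1 hy j
    rw [abs_le]; omega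
  · have := hx j
    have h3 := abs_le.1 (le_refl |x j|)
    omega
  · refine mem_centredBox.2 fun j => ?_
    have := hy j
    rw [abs_le]; omega
  · gcongr
    have h3 : L + (3 * J + 1) * L ≤ L' / 16 := by
      have : L + (3 * J + 1) * L = 2 * L + 3 * (J * L) := by ring
      rw [this]; omega
    have h4 : (L : ℝ) + (3 * J + 1) * L ≤ ((L' / 16 : ℕ) : ℝ) := by exact_mod_cast h3
    linarith

/-- If the central box is resonant, then solutions decay away from it. -/
lemma norm_apply_le_of_isResonant (h : SparseAtAllScales V m b J E ℓ) (hd : 1 ≤ d)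
    (hm : 0 ≤ m) {k : ℕ} (hres : IsResonant V m b J E (ℓ k) (centredBox d (ℓ (k + 1) / 8)))
    {f : Lattice d → ℂ}
    (hf : ∀ y ∈ centredBox d (ℓ (k + 2)), formalSchrodinger V f y = E * f y) {y : Lattice d}
    {i : Fin d} (hi : ∀ j, |y j| ≤ |y i|) {δ : ℕ} (hδ : 2 * δ ≤ ℓ (k + 1))
    (hy1 : (ℓ (k + 1) / 8 : ℕ) + 1 + (δ : ℤ) ≤ |y i|) (hy2 : |y i| + ℓ (k + 1) ≤ ℓ (k + 2))
    {M : ℝ} (hM0 : 0 ≤ M)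
    (hM : ∀ y', (∀ j, |y' j - y j| ≤ ℓ (k + 1) + 1) → ‖f y'‖ ≤ M) :
    ‖f y‖ ≤ Real.exp (-(m * (δ - (3 * J + 1) * ℓ k))) * M := by
  have hg := h.scales k
  have hmul := hg.mul_le
  have h2 := hg.le_two_mul
  have hmul' := (h.scales (k + 1)).mul_le
  have hsing := h.singular k
  have hres2 := h.resonant k
  set L := ℓ k
  set L' := ℓ (k + 1)
  set q := L' / 8 with hq
  have hLL' : 1000 * L + 1000 * (J * L) ≤ L' := by linarith
  have hL'' : L' ≤ ℓ (k + 2) := (h.scales (k + 1)).le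
  set L'' := ℓ (k + 2)
  -- Both rectangles have their short side along the dominant coordinate of `y`. The first starts
  -- `δ` closer to the origin than `y`; the second contains the central box and ends at its face
  -- towards `y`. They are disjoint since `|y i| - δ` exceeds `q`.
  obtain ⟨lo, lo₀, hlo, hlo₀⟩ : ∃ lo lo₀ : ℤ,
      (y i = |y i| ∧ lo = y i - δ ∨ y i = -|y i| ∧ lo = y i + δ - L') ∧
      (y i = |y i| ∧ lo₀ = q - L' ∨ y i = -|y i| ∧ lo₀ = -q) := by
    rcases abs_choice (y i) with h | h
    · exact ⟨y i - δ, q - L', Or.inl ⟨h.symm, rfl⟩, Or.inl ⟨h.symm, rfl⟩⟩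
    · exact ⟨y i + δ - L', -q, Or.inr ⟨by omega, rfl⟩, Or.inr ⟨by omega, rfl⟩⟩
  let a : Lattice d := fun j => if j = i then lo else y j - L'
  let a₀ : Lattice d := fun j => if j = i then lo₀ else -L'
  let c : Lattice d := fun j => a j + if j = i then (L' : ℤ) else 2 * (L' : ℤ)
  let c₀ : Lattice d := fun j => a₀ j + if j = i then (L' : ℤ) else 2 * (L' : ℤ)
  have hac : ∀ j, (j = i ∧ a j = lo ∧ c j = lo + L' ∧ a₀ j = lo₀ ∧ c₀ j = lo₀ + L') ∨
      (j ≠ i ∧ a j = y j - L' ∧ c j = y j + L' ∧ a₀ j = -L' ∧ c₀ j = L') := by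
    intro j
    by_cases hj : j = i
    · subst hj; simp [a, c, a₀, c₀]
    · refine Or.inr ⟨hj, ?_⟩
      simp only [a, c, a₀, c₀, if_neg hj, true_and]
      constructor <;> ring
  have hR : IsRectangle L' (Finset.Icc a c) := ⟨a, i, rfl⟩
  have hR₀ : IsRectangle L' (Finset.Icc a₀ c₀) := ⟨a₀, i, rfl⟩
  have hsubR : Finset.Icc a c ⊆ centredBox d L'' := fun w hw => mem_centredBox.2 fun j => by
    have h3 := mem_box.1 hw j
    have h4 := hac j
    have h5 := abs_le.1 (hi j)
    rw [abs_le]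
    rcases h4 with ⟨rfl, h4⟩ | h4 <;> omega
  have hsubR₀ : Finset.Icc a₀ c₀ ⊆ centredBox d L'' := fun w hw => mem_centredBox.2 fun j => by
    have h3 := mem_box.1 hw j
    have h4 := hac j
    rw [abs_le]
    omega
  have hsubQ : centredBox d q ⊆ Finset.Icc a₀ c₀ := fun w hw => mem_box.2 fun j => by
    have h3 := abs_le.1 (mem_centredBox.1 hw j)
    have h4 := hac j
    omega
  have hdisj : Disjoint (Finset.Icc a₀ c₀) (Finset.Icc a c) := by
    rw [Finset.disjoint_left]
    intro w hw hw'
    have h3 := mem_box.1 hw i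
    have h4 := mem_box.1 hw' i
    have h5 := hac i
    omega
  -- The second rectangle inherits the resonance of the central box, so `2`-sparsity leaves none for
  -- the first.
  have hnres : ¬ IsResonant V m b J E L (Finset.Icc a c) := by
    intro hcon
    refine hres2 ⟨![Finset.Icc a₀ c₀, Finset.Icc a c], ?_, ?_⟩
    · intro j
      fin_cases j
      · exact ⟨⟨hR₀, hres.mono hsubQ⟩, hsubR₀⟩
      · exact ⟨⟨hR, hcon⟩, hsubR⟩
    · intro j j' hjj'
      fin_cases j <;> fin_cases j'
      · exact absurd rfl hjj'
      · exact hdisj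
      · exact hdisj.symm
      · exact absurd rfl hjj'
  refine hg.norm_apply_le hd hm (fun j => ?_) (fun j => ?_) hnres (hsing _ hR)
    (fun w hw => hf w (hsubR hw)) (fun j => ?_) hM0 (fun y' hy' => hM y' fun j => ?_)
  · have := hac j; omega
  · have := hac j; omega
  · have := hac j
    rcases this with ⟨rfl, h4⟩ | h4 <;> omega
  · have h3 := hy' j
    have h4 := hac j
    rw [abs_le]
    rcases h4 with ⟨rfl, h4⟩ | h4 <;> omega

/-- Exponential decay of solutions in the annulus between two scales around a resonant box. -/
lemma norm_apply_le_exp (h : SparseAtAllScales V m b J E ℓ) (hd : 1 ≤ d)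
    (hm : 0 ≤ m) {k : ℕ} (hres : IsResonant V m b J E (ℓ k) (centredBox d (ℓ (k + 1) / 8)))
    {f : Lattice d → ℂ}
    (hf : ∀ y ∈ centredBox d (ℓ (k + 2)), formalSchrodinger V f y = E * f y) {y : Lattice d}
    {i : Fin d} (hi : ∀ j, |y j| ≤ |y i|) {r : ℕ} (hr : |y i| = r) (hr1 : ℓ (k + 1) ≤ 4 * r)
    (hr2 : 4 * r ≤ ℓ (k + 2)) {M : ℝ} (hM0 : 0 ≤ M)
    (hM : ∀ y' ∈ centredBox d (6 * r), ‖f y'‖ ≤ M) :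
    ‖f y‖ ≤ Real.exp (-(m / 16 * r)) * M := by
  have hstep : ∀ (y : Lattice d) (i : Fin d), (∀ j, |y j| ≤ |y i|) → ∀ δ : ℕ, 2 * δ ≤ ℓ (k + 1) →
      (ℓ (k + 1) / 8 : ℕ) + 1 + (δ : ℤ) ≤ |y i| → |y i| + ℓ (k + 1) ≤ ℓ (k + 2) → ∀ M : ℝ, 0 ≤ M →
      (∀ y', (∀ j, |y' j - y j| ≤ ℓ (k + 1) + 1) → ‖f y'‖ ≤ M) →
      ‖f y‖ ≤ Real.exp (-(m * (δ - (3 * J + 1) * ℓ k))) * M :=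
    fun y i hi δ hδ h1 h2 M hM0 hM => h.norm_apply_le_of_isResonant hd hm hres hf hi hδ h1 h2 hM0 hM
  have hg := h.scales k
  have hmul := hg.mul_le
  have h2 := hg.le_two_mul
  have hmul' := (h.scales (k + 1)).mul_le
  have hLL' : 1000 * ℓ k + 1000 * (J * ℓ k) ≤ ℓ (k + 1) := by linarith
  have hLL'' : 1000 * ℓ (k + 1) ≤ ℓ (k + 2) := by
    change 1000 * (J + 1) * ℓ (k + 1) ≤ ℓ (k + 2) at hmul'
    have : 1000 * ℓ (k + 1) + 1000 * (J * ℓ (k + 1)) ≤ ℓ (k + 2) := by linarith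
    omega
  have hJL : ((3 * (J : ℝ) + 1) * ℓ k) ≤ ℓ (k + 1) / 250 - 1 := by
    have h3 : 250 * ((3 * J + 1) * ℓ k + 1) ≤ ℓ (k + 1) := by
      have : 250 * ((3 * J + 1) * ℓ k + 1) = 750 * (J * ℓ k) + 250 * ℓ k + 250 := by ring
      omega
    have h4 : 250 * ((3 * (J : ℝ) + 1) * ℓ k + 1) ≤ ℓ (k + 1) := by exact_mod_cast h3
    linarith
  have hL' : 1000 ≤ ℓ (k + 1) := by omega
  set L := ℓ k
  set L' := ℓ (k + 1)
  set L'' := ℓ (k + 2)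
  have hL'r : (1000 : ℝ) ≤ L' := by exact_mod_cast hL'
  have hr1' : (L' : ℝ) ≤ 4 * r := by exact_mod_cast hr1
  -- For `L' / 4 ≤ r ≤ 4 L'` one step suffices: its depth is at least `r / 8 - 1`, and half of `r /
  -- 8` covers the losses. It looks no farther than `r + L' + 1 ≤ 6 r`, the source of the factor
  -- `6`.
  rcases le_total r (4 * L') with hcase | hcase
  · have hcase' : (r : ℝ) ≤ 4 * L' := by exact_mod_cast hcase
    refine (hstep y i hi (min (L' / 2) (r - L' / 8 - 1)) (by omega) (by omega) (by omega) M hM0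
      fun y' hy' => hM y' ?_).trans ?_
    · refine mem_centredBox.2 fun j => ?_
      have h3 := abs_le.1 (hy' j)
      have h4 := abs_le.1 (hi j)
      rw [abs_le]
      push_cast
      omega
    · refine mul_le_mul_of_nonneg_right (Real.exp_le_exp.2 (neg_le_neg ?_)) hM0
      have h3 : r ≤ 8 * min (L' / 2) (r - L' / 8 - 1) + 8 := by omega
      have h4 : (r : ℝ) ≤ 8 * (min (L' / 2) (r - L' / 8 - 1) : ℕ) + 8 := by exact_mod_cast h3
      rw [div_mul_eq_mul_div, mul_div_assoc]
      gcongr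
      linarith
  · have hcase' : 4 * (L' : ℝ) ≤ r := by exact_mod_cast hcase
    -- For larger `r`, take steps of depth `L' / 2`, as many as keep the chain within `r / 2` of
    -- `y`, hence in the annulus where the one-step bound applies. Each gains at least `(3 / 8) m
    -- L'`.
    set n := r / (2 * (L' + 1)) with hn
    have hn1 : n * (L' + 1) * 2 ≤ r := by
      have := Nat.div_mul_le_self r (2 * (L' + 1))
      rw [← hn] at this
      linarith
    have hn2 : r < (n + 1) * (2 * (L' + 1)) := by
      have := Nat.lt_mul_div_succ r (show 0 < 2 * (L' + 1) by omega)
      rw [← hn] at this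
      linarith
    have hnball : ∀ y' : Lattice d, (∀ j, |y' j - y j| ≤ (n : ℤ) * ((L' + 1 : ℕ) : ℤ)) →
        ∀ j, 2 * |y' j - y j| ≤ r := by
      intro y' hy' j
      have h3 := hy' j
      have h4 : (n : ℤ) * ((L' + 1 : ℕ) : ℤ) * 2 ≤ r := by exact_mod_cast hn1
      linarith
    refine (norm_apply_le_pow (D := L' + 1)
      (q := Real.exp (-(m * ((L' / 2 : ℕ) - (3 * J + 1) * L))))
      (Real.exp_pos _).le hM0 n (y := y) (fun y' hy' M' hM'0 hM' => ?_) (fun y' hy' => ?_)).trans ?_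
    · have : Nonempty (Fin d) := ⟨i⟩
      obtain ⟨i', hi'⟩ := Finite.exists_max fun j => |y' j|
      have h3 := hnball y' hy'
      have h4 := h3 i
      have h5 := h3 i'
      have h6 := hi i'
      have h7 := hi' i
      have h8 : |y i| ≤ |y' i| + |y' i - y i| := by
        have := abs_sub_abs_le_abs_sub (y i) (y' i)
        rw [abs_sub_comm (y i)] at this
        linarith
      have h9 : |y' i'| ≤ |y i'| + |y' i' - y i'| := by
        have := abs_sub_abs_le_abs_sub (y' i') (y i')
        linarith
      refine hstep y' i' hi' (L' / 2) (by omega) (by omega) (by omega) M' hM'0 fun y'' hy'' => ?_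
      exact hM' y'' (by simpa using hy'')
    · refine hM y' (mem_centredBox.2 fun j => ?_)
      have h3 := hnball y' hy' j
      have h4 := hi j
      have h5 := abs_sub_abs_le_abs_sub (y' j) (y j)
      push_cast
      omega
    · gcongr
      rw [← Real.exp_nat_mul]
      refine Real.exp_le_exp.2 ?_
      have h3 : (L' : ℝ) ≤ 2 * (L' / 2 : ℕ) + 1 := by
        have : L' ≤ 2 * (L' / 2) + 1 := by omega
        exact_mod_cast this
      have h4 : 3 / 8 * (L' : ℝ) ≤ ((L' / 2 : ℕ) : ℝ) - (3 * J + 1) * L := by linarith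
      have h5 : (r : ℝ) < (n + 1) * (2 * (L' + 1)) := by exact_mod_cast hn2
      have h6 : (r : ℝ) / 16 ≤ n * (3 / 8 * (L' : ℝ)) := by nlinarith
      have h7 : (n : ℝ) * (3 / 8 * (L' : ℝ)) ≤ n * (((L' / 2 : ℕ) : ℝ) - (3 * J + 1) * L) := by
        gcongr
      have h8 : m * ((r : ℝ) / 16) ≤ m * (n * (((L' / 2 : ℕ) : ℝ) - (3 * J + 1) * L)) := by
        gcongr
        exact h6.trans h7
      linarith

end SparseAtAllScales

/-! ### Reality of eigenvalues and exponential decay of eigenfunctions -/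

lemma mem_centredBox_iff_norm_le {L : ℕ} {x : Lattice d} : x ∈ centredBox d L ↔ ‖x‖ ≤ L := by
  rw [mem_centredBox, pi_norm_le_iff_of_nonneg (Nat.cast_nonneg L)]
  refine forall_congr' fun j => ?_
  rw [Int.norm_eq_abs]
  exact_mod_cast Iff.rfl

lemma exists_norm_eq (hd : 1 ≤ d) (y : Lattice d) :
    ∃ (i : Fin d) (r : ℕ), (∀ j, |y j| ≤ |y i|) ∧ |y i| = r ∧ ‖y‖ = r := by
  have : Nonempty (Fin d) := ⟨⟨0, hd⟩⟩
  obtain ⟨i, hi⟩ := Finite.exists_max fun j => |y j|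
  refine ⟨i, (y i).natAbs, hi, Int.abs_eq_natAbs _, le_antisymm ?_ ?_⟩
  · rw [← mem_centredBox_iff_norm_le, mem_centredBox]
    intro j
    rw [← Int.abs_eq_natAbs]
    exact hi j
  · refine le_trans (le_of_eq ?_) (norm_le_pi_norm y i)
    rw [Int.norm_eq_abs, Nat.cast_natAbs]
    push_cast
    rfl

lemma summable_norm_sq (ψ : Ell2 d) : Summable fun x => ‖ψ x‖ ^ 2 := by
  have := (lp.memℓp ψ).summable (by norm_num)
  simpa using this

/-- Eigenvalues are real. -/
lemma im_eq_zero_of_eigenfunction {V : Lattice d → ℝ} {f : Lattice d → ℂ}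
    (hs : Summable fun x => ‖f x‖ ^ 2) {x₀ : Lattice d} (hx₀ : f x₀ ≠ 0) {E : ℂ}
    (hE : ∀ x, formalSchrodinger V f x = E * f x) : E.im = 0 := by
  -- The probability current through the bond from `x` to `x + e_i`. It is summable for
  -- square-summable `f`, and its divergence is `E.im * ‖f x‖ ^ 2`; the divergence sums to zero by
  -- translation invariance.
  let h : Fin d → Lattice d → ℝ := fun i x => (conj (f x) * f (x + Pi.single i 1)).im
  have hh : ∀ i, Summable (h i) := by
    intro i
    have hs' : Summable fun x => ‖f (x + Pi.single i 1)‖ ^ 2 :=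
      hs.comp_injective (add_left_injective (Pi.single i 1 : Lattice d))
    refine Summable.of_norm_bounded (hs.add hs') fun x => ?_
    refine (Complex.abs_im_le_norm _).trans ?_
    rw [norm_mul, RCLike.norm_conj]
    nlinarith [sq_nonneg (‖f x‖ - ‖f (x + Pi.single i 1)‖), norm_nonneg (f x),
      norm_nonneg (f (x + Pi.single i 1))]
  have hpt : ∀ x, E.im * ‖f x‖ ^ 2 = ∑ i, (h i x - h i (x - Pi.single i 1)) := by
    intro x
    have h1 : (conj (f x) * formalSchrodinger V f x).im = E.im * ‖f x‖ ^ 2 := by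
      rw [hE, mul_left_comm, mul_comm (conj (f x)), Complex.mul_conj, Complex.normSq_eq_norm_sq,
        Complex.im_mul_ofReal]
    rw [← h1, formalSchrodinger_apply, mul_add, Complex.add_im, Finset.mul_sum, Complex.im_sum]
    have h2 : (conj (f x) * ((V x : ℂ) * f x)).im = 0 := by
      rw [mul_left_comm, mul_comm (conj (f x)), Complex.mul_conj, ← Complex.ofReal_mul,
        Complex.ofReal_im]
    rw [h2, add_zero]
    refine Finset.sum_congr rfl fun i _ => ?_
    simp only [h, sub_add_cancel, mul_add, Complex.add_im, Complex.mul_im, Complex.conj_re,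
      Complex.conj_im]
    ring
  have hsum : HasSum (fun x => E.im * ‖f x‖ ^ 2) 0 := by
    simp only [hpt]
    rw [← Finset.sum_const_zero (s := (Finset.univ : Finset (Fin d)))]
    refine hasSum_sum fun i _ => ?_
    have h1 := (hh i).hasSum
    have h2 : HasSum (h i ∘ Equiv.subRight (Pi.single i 1 : Lattice d)) (∑' x, h i x) :=
      (Equiv.hasSum_iff _).2 h1
    have h3 := h1.sub h2
    rw [sub_self] at h3
    exact h3
  have h3 := (hs.hasSum.mul_left E.im).unique hsum
  refine (mul_eq_zero.1 h3).resolve_right (ne_of_gt ?_)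
  exact hs.tsum_pos (fun x => by positivity) x₀ (by positivity)

lemma le_scale {m b : ℝ} {J : ℕ} {ℓ : ℕ → ℕ} (h : ∀ k, GoodScales d m b J (ℓ k) (ℓ (k + 1)))
    (k : ℕ) : k ≤ ℓ k := by
  induction k with
  | zero => exact Nat.zero_le _
  | succ k ih =>
    have h1 := (h k).mul_le
    have h2 := (h k).le_two_mul
    nlinarith

lemma monotone_scale {m b : ℝ} {J : ℕ} {ℓ : ℕ → ℕ}
    (h : ∀ k, GoodScales d m b J (ℓ k) (ℓ (k + 1))) : Monotone ℓ :=
  monotone_nat_of_le_succ fun k => (h k).le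

/-- Exponential decay of solutions over a range of scales at which the central box is resonant. -/
lemma SparseAtAllScales.norm_apply_le_exp_of_forall {V : Lattice d → ℝ} {m b : ℝ} {J : ℕ} {E : ℝ}
    {ℓ : ℕ → ℕ} (h : SparseAtAllScales V m b J E ℓ) (hd : 1 ≤ d) (hm : 0 ≤ m) {K n : ℕ}
    (hres : ∀ k, K ≤ k → k ≤ n → IsResonant V m b J E (ℓ k) (centredBox d (ℓ (k + 1) / 8)))
    {f : Lattice d → ℂ}
    (hf : ∀ y ∈ centredBox d (ℓ (n + 2)), formalSchrodinger V f y = E * f y) {y : Lattice d}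
    (hy1 : ℓ (K + 1) ≤ 4 * ‖y‖) (hy2 : 4 * ‖y‖ ≤ ℓ (n + 2)) (hKn : K ≤ n) {M : ℝ} (hM0 : 0 ≤ M)
    (hM : ∀ y', ‖y'‖ ≤ 6 * ‖y‖ → ‖f y'‖ ≤ M) :
    ‖f y‖ ≤ Real.exp (-(m / 16 * ‖y‖)) * M := by
  obtain ⟨i, r, hi, hr, hyr⟩ := exists_norm_eq hd y
  rw [hyr] at hy1 hy2 hM ⊢
  have hy1' : ℓ (K + 1) ≤ 4 * r := by exact_mod_cast hy1
  have hy2' : 4 * r ≤ ℓ (n + 2) := by exact_mod_cast hy2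
  have hmono := monotone_scale h.scales
  have hex : ∃ k, K ≤ k ∧ k ≤ n ∧ ℓ (k + 1) ≤ 4 * r ∧ 4 * r ≤ ℓ (k + 2) := by
    clear hf hy2 hres
    induction n, hKn using Nat.le_induction with
    | base => exact ⟨K, le_rfl, le_rfl, hy1', hy2'⟩
    | succ n hn ih =>
      rcases le_total (4 * r) (ℓ (n + 2)) with h' | h'
      · obtain ⟨k, h1, h2, h3⟩ := ih h'
        exact ⟨k, h1, by omega, h3⟩
      · exact ⟨n + 1, by omega, le_rfl, h', hy2'⟩
  obtain ⟨k, h1, h2, h3, h4⟩ := hex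
  have hle : ℓ (k + 2) ≤ ℓ (n + 2) := hmono (by omega)
  refine h.norm_apply_le_exp hd hm (hres k h1 h2) (fun w hw => hf w ?_) hi hr h3 h4 hM0
    fun y' hy' => hM y' ?_
  · rw [mem_centredBox_iff_norm_le] at hw ⊢
    exact hw.trans (by exact_mod_cast hle)
  · rw [mem_centredBox_iff_norm_le] at hy'
    exact_mod_cast hy'

/-- Membership in the domain is automatic for a square-summable solution, since `H ψ` is then a
multiple of `ψ`. -/
lemma isEigenfunction_iff {V : Lattice d → ℝ} {ψ : Ell2 d} :
    IsEigenfunction (schrodinger V) ψ ↔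
      ψ ≠ 0 ∧ ∃ E : ℂ, ∀ x, formalSchrodinger V ψ x = E * ψ x := by
  refine and_congr_right fun _ => exists_congr fun E => ⟨?_, ?_⟩
  · rintro ⟨h, hE⟩ x
    have := congrArg (fun g : Ell2 d => g x) hE
    simpa [schrodinger] using this
  · intro hE
    have hfun : formalSchrodinger V ψ = E • (ψ : Lattice d → ℂ) := funext fun x => by simp [hE]
    have hmem : ψ ∈ (schrodinger V).domain := by
      change Memℓp (formalSchrodinger V ψ) 2
      rw [hfun]
      exact (lp.memℓp ψ).const_smul E
    refine ⟨hmem, lp.ext ?_⟩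
    exact hfun

/-- Exponential localization of eigenfunctions. -/
lemma exponential_localization (hd : 1 ≤ d) {V : Lattice d → ℝ} {m b : ℝ} {J : ℕ} {ℓ : ℕ → ℕ}
    (hm : 0 < m) (h : ∀ E : ℝ, SparseAtAllScales V m b J E ℓ) {ψ : Ell2 d}
    (hψ : IsEigenfunction (schrodinger V) ψ) :
    ∃ C : ℝ, ∀ x : Lattice d, ‖ψ x‖ * Real.exp (m / 16 * ‖x‖) ≤ C := by
  obtain ⟨hψ0, E', hE'⟩ := isEigenfunction_iff.1 hψ
  obtain ⟨x, hx⟩ : ∃ x, ψ x ≠ 0 := by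
    by_contra hcon
    push Not at hcon
    exact hψ0 (lp.ext (funext hcon))
  obtain ⟨E, rfl⟩ : ∃ E : ℝ, (E : ℂ) = E' :=
    ⟨E'.re, Complex.ext rfl (im_eq_zero_of_eigenfunction (summable_norm_sq ψ) hx hE').symm⟩
  have hA : ∀ y, ‖ψ y‖ ≤ ‖ψ‖ := lp.norm_apply_le_norm two_ne_zero ψ
  have hscales := (h E).scales
  -- Non-resonance at infinitely many scales would force `ψ x = 0`, because `ψ` is bounded.
  have hres : ∃ K, ∀ k, K ≤ k →
      IsResonant V m b J E (ℓ k) (centredBox d (ℓ (k + 1) / 8)) := by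
    by_contra hcon
    push Not at hcon
    have hle : ∀ K : ℕ, ∃ k, K ≤ k ∧ ‖ψ x‖ ≤ Real.exp (-(m * k)) * ‖ψ‖ := by
      intro K
      obtain ⟨i, r, hi, hr, -⟩ := exists_norm_eq hd x
      obtain ⟨k, hk, hnres⟩ := hcon (max K (32 * r))
      refine ⟨k, (le_max_left _ _).trans hk, ?_⟩
      have h1 := le_scale hscales (k + 1)
      have h2 := le_scale hscales k
      refine ((h E).norm_apply_le_of_not_isResonant hd hm.le hnres (fun y _ => hE' y)
        (fun j => ?_) (norm_nonneg _) (fun y _ => hA y)).trans ?_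
      · have := hi j
        omega
      · gcongr
    have hlim : Tendsto (fun k : ℕ => Real.exp (-(m * k)) * ‖ψ‖) atTop (𝓝 0) := by
      have : Tendsto (fun k : ℕ => m * (k : ℝ)) atTop atTop :=
        tendsto_natCast_atTop_atTop.const_mul_atTop hm
      simpa using (Real.tendsto_exp_neg_atTop_nhds_zero.comp this).mul_const ‖ψ‖
    have hev := (hlim.eventually (gt_mem_nhds (norm_pos_iff.2 hx)))
    obtain ⟨K, hK⟩ := eventually_atTop.1 hev
    obtain ⟨k, hk, hk'⟩ := hle K
    exact absurd (hK k hk) (not_lt.2 hk')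
  obtain ⟨K, hK⟩ := hres
  refine ⟨‖ψ‖ * Real.exp (m / 16 * ℓ (K + 1)), fun y => ?_⟩
  rcases le_total ((ℓ (K + 1) : ℝ)) (4 * ‖y‖) with hy | hy
  · obtain ⟨n, hn⟩ := exists_nat_ge (4 * ‖y‖)
    have h1 : ((max n K : ℕ) : ℝ) ≤ ℓ (max n K + 2) := by
      exact_mod_cast (le_scale hscales _).trans (monotone_scale hscales (by omega))
    have h2 : (n : ℝ) ≤ (max n K : ℕ) := by exact_mod_cast le_max_left n K
    have h3 := (h E).norm_apply_le_exp_of_forall hd hm.le (K := K) (n := max n K)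
      (fun k hk _ => hK k hk) (fun y _ => hE' y) hy (by linarith) (le_max_right _ _)
      (norm_nonneg ψ) (fun y' _ => hA y')
    calc ‖ψ y‖ * Real.exp (m / 16 * ‖y‖)
        ≤ Real.exp (-(m / 16 * ‖y‖)) * ‖ψ‖ * Real.exp (m / 16 * ‖y‖) := by gcongr
      _ = ‖ψ‖ * 1 := by
        rw [mul_right_comm, ← Real.exp_add, neg_add_cancel, Real.exp_zero]; ring
      _ ≤ _ := by
        gcongr
        exact Real.one_le_exp (by positivity)
  · gcongr
    · exact hA y
    · linarith [norm_nonneg y]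

/-! ### Limits of uniformly localized approximate solutions -/

/-- The sup norm dominates the average of the `|y i|`, so a product of one-dimensional geometric
series dominates. -/
lemma summable_exp_neg_mul_norm (hd : 1 ≤ d) {c : ℝ} (hc : 0 < c) :
    Summable fun y : Lattice d => Real.exp (-(c * ‖y‖)) := by
  have hd' : (0 : ℝ) < d := by exact_mod_cast hd
  let g : ℤ → ℝ := fun n => Real.exp (-(c / d * |(n : ℝ)|))
  have hg0 : ∀ n, 0 ≤ g n := fun n => (Real.exp_pos _).le
  have hnat : Summable fun n : ℕ => Real.exp (-(c / d * n)) := by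
    have := Real.summable_exp_nat_mul_iff.2 (show -(c / d) < 0 by simpa using div_pos hc hd')
    refine this.congr fun n => ?_
    congr 1; ring
  have hg : Summable g := by
    refine Summable.of_nat_of_neg (hnat.congr fun n => ?_) (hnat.congr fun n => ?_) <;> simp [g]
  have hprod : Summable fun y : Lattice d => ∏ i, g (y i) := by
    refine summable_of_sum_le (c := (∑' n, g n) ^ d)
      (fun y => Finset.prod_nonneg fun i _ => hg0 _) fun s => ?_
    classical
    let t : Fin d → Finset ℤ := fun i => s.image fun y => y i
    have hsub : s ⊆ Fintype.piFinset t := fun y hy =>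
      Fintype.mem_piFinset.2 fun i => Finset.mem_image_of_mem _ hy
    calc ∑ y ∈ s, ∏ i, g (y i) ≤ ∑ y ∈ Fintype.piFinset t, ∏ i, g (y i) :=
          Finset.sum_le_sum_of_subset_of_nonneg hsub
            fun y _ _ => Finset.prod_nonneg fun i _ => hg0 _
      _ = ∏ i, ∑ n ∈ t i, g n := (Finset.prod_univ_sum t fun _ n => g n).symm
      _ ≤ ∏ _i : Fin d, ∑' n, g n := by
          refine Finset.prod_le_prod (fun i _ => Finset.sum_nonneg fun n _ => hg0 n) fun i _ => ?_
          exact hg.sum_le_tsum _ fun n _ => hg0 n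
      _ = _ := by simp
  refine Summable.of_nonneg_of_le (fun y => (Real.exp_pos _).le) (fun y => ?_) hprod
  rw [← Real.exp_sum]
  refine Real.exp_le_exp.2 ?_
  rw [Finset.sum_neg_distrib, neg_le_neg_iff]
  calc ∑ i, c / d * |(y i : ℝ)| ≤ ∑ _i : Fin d, c / d * ‖y‖ := by
        refine Finset.sum_le_sum fun i _ => ?_
        have : |(y i : ℝ)| ≤ ‖y‖ := by
          have := norm_le_pi_norm y i
          rwa [Int.norm_eq_abs] at this
        gcongr
    _ = c * ‖y‖ := by
        simp only [Finset.sum_const, Finset.card_univ, Fintype.card_fin, nsmul_eq_mul]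
        field_simp

/-- A single ultrafilter gives the limits at all lattice points and of the energies at once, without
diagonal subsequences. -/
lemma exists_tendsto_of_bounded {X : Type*} [PseudoMetricSpace X] [ProperSpace X] {ι : Type*}
    (𝒰 : Ultrafilter ι) (u : ι → X) (x₀ : X) (A : ℝ)
    (hu : ∀ᶠ n in (𝒰 : Filter ι), dist (u n) x₀ ≤ A) :
    ∃ x, Tendsto u 𝒰 (𝓝 x) := by
  obtain ⟨x, -, hx⟩ := (isCompact_closedBall x₀ A).ultrafilter_le_nhds (𝒰.map u)
    (by rw [le_principal_iff]; exact hu)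
  exact ⟨x, hx⟩

/-- A uniformly localized sequence of solutions on growing boxes has an eigenfunction as a limit
point. -/
lemma exists_eigenfunction_of_approximate (hd : 1 ≤ d) {V : Lattice d → ℝ} {f : Ell2 d}
    {A c δ : ℝ} (hc : 0 < c) (hδ : 0 < δ) {C : ℕ}
    (h : ∀ R : ℕ, ∃ (u : Lattice d → ℂ) (E : ℝ), (∀ y, ‖u y‖ ≤ A * Real.exp (-(c * ‖y‖))) ∧
      (∀ y ∈ centredBox d R, formalSchrodinger V u y = E * u y) ∧
      (∃ y ∈ centredBox d C, 1 ≤ ‖u y‖) ∧ δ ≤ ‖∑' y, conj (u y) * f y‖) :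
    ∃ ψ : Ell2 d, IsEigenfunction (schrodinger V) ψ ∧ inner ℂ ψ f ≠ 0 := by
  choose u En hu hE hC hδu using h
  have hA : 0 ≤ A := by
    have := (norm_nonneg _).trans (hu 0 0)
    simpa using this
  have hexp1 : ∀ y : Lattice d, Real.exp (-(c * ‖y‖)) ≤ 1 := fun y =>
    Real.exp_le_one_iff.2 (neg_nonpos.2 (by positivity))
  have huA : ∀ n y, ‖u n y‖ ≤ A := fun n y =>
    (hu n y).trans (mul_le_of_le_one_right hA (hexp1 y))
  let 𝒰 : Ultrafilter ℕ := hyperfilter ℕ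
  have h𝒰 : (𝒰 : Filter ℕ) ≤ atTop := Nat.hyperfilter_le_atTop
  have hlim : ∀ y, ∃ z, Tendsto (fun n => u n y) 𝒰 (𝓝 z) := fun y =>
    exists_tendsto_of_bounded 𝒰 _ 0 A (Eventually.of_forall fun n => by simpa using huA n y)
  choose φ hφ using hlim
  -- The equation at a point of the fixed box where `1 ≤ ‖u n y‖` bounds the energies, although `V`
  -- may be unbounded.
  have hEbdd : ∀ᶠ n in (𝒰 : Filter ℕ), dist (En n) 0 ≤
      2 * d * A + (∑ y ∈ centredBox d C, |V y|) * A := by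
    filter_upwards [h𝒰 (eventually_ge_atTop C)] with n hn
    obtain ⟨y, hy, hy1⟩ := hC n
    have hyn : y ∈ centredBox d n := by
      rw [mem_centredBox_iff_norm_le] at hy ⊢
      exact hy.trans (by exact_mod_cast hn)
    have h1 : ‖(En n : ℂ) * u n y‖ ≤ 2 * d * A + |V y| * A := by
      rw [← hE n y hyn, formalSchrodinger_apply]
      refine (norm_add_le _ _).trans (add_le_add ?_ ?_)
      · refine (norm_sum_le _ _).trans ?_
        calc _ ≤ ∑ _i : Fin d, (A + A) := Finset.sum_le_sum fun i _ =>
              (norm_add_le _ _).trans (add_le_add (huA n _) (huA n _))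
          _ = 2 * d * A := by simp; ring
      · rw [norm_mul, Complex.norm_real, Real.norm_eq_abs]
        gcongr
        exact huA n y
    have h2 : |V y| ≤ ∑ y ∈ centredBox d C, |V y| :=
      Finset.single_le_sum (f := fun y => |V y|) (fun y _ => abs_nonneg _) hy
    rw [norm_mul, Complex.norm_real] at h1
    rw [dist_zero_right]
    calc ‖En n‖ ≤ ‖En n‖ * ‖u n y‖ := le_mul_of_one_le_right (norm_nonneg _) hy1
      _ ≤ _ := h1.trans (by gcongr)
  obtain ⟨E, hElim⟩ := exists_tendsto_of_bounded 𝒰 En 0 _ hEbdd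
  have hφA : ∀ y, ‖φ y‖ ≤ A * Real.exp (-(c * ‖y‖)) := fun y =>
    le_of_tendsto (hφ y).norm (Eventually.of_forall fun n => hu n y)
  have hsum := summable_exp_neg_mul_norm hd hc
  have hmem : Memℓp φ 2 := by
    refine memℓp_gen ?_
    refine Summable.of_nonneg_of_le (fun y => by positivity) (fun y => ?_) (hsum.mul_left (A ^ 2))
    have h1 := hφA y
    have h2 := hexp1 y
    have h3 := (Real.exp_pos (-(c * ‖y‖))).le
    simp only [ENNReal.toReal_ofNat, Real.rpow_ofNat]
    calc ‖φ y‖ ^ 2 ≤ (A * Real.exp (-(c * ‖y‖))) ^ 2 := by gcongr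
      _ = A ^ 2 * (Real.exp (-(c * ‖y‖)) * Real.exp (-(c * ‖y‖))) := by ring
      _ ≤ A ^ 2 * (Real.exp (-(c * ‖y‖)) * 1) := by gcongr
      _ = _ := by ring
  have heq : ∀ y, formalSchrodinger V φ y = E * φ y := by
    intro y
    have h1 : Tendsto (fun n => formalSchrodinger V (u n) y) 𝒰 (𝓝 (formalSchrodinger V φ y)) := by
      simp only [formalSchrodinger_apply]
      refine (tendsto_finsetSum _ fun i _ => (hφ _).add (hφ _)).add ((hφ y).const_mul _)
    have h2 : Tendsto (fun n => (En n : ℂ) * u n y) 𝒰 (𝓝 (E * φ y)) :=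
      ((Complex.continuous_ofReal.tendsto E).comp hElim).mul (hφ y)
    refine tendsto_nhds_unique (h1.congr' ?_) h2
    obtain ⟨N, hN⟩ := exists_nat_ge ‖y‖
    filter_upwards [h𝒰 (eventually_ge_atTop N)] with n hn
    refine hE n y (mem_centredBox_iff_norm_le.2 (hN.trans (by exact_mod_cast hn)))
  -- The mass cannot escape: the point with `1 ≤ ‖u n y‖` ranges over a fixed finite box.
  have hne : φ ≠ 0 := by
    intro h0
    have h1 : Tendsto (fun n => ∑ y ∈ centredBox d C, ‖u n y‖) 𝒰
        (𝓝 (∑ y ∈ centredBox d C, ‖φ y‖)) := tendsto_finsetSum _ fun y _ => (hφ y).norm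
    have h2 : (1 : ℝ) ≤ ∑ y ∈ centredBox d C, ‖φ y‖ :=
      ge_of_tendsto h1 (Eventually.of_forall fun n => by
        obtain ⟨y, hy, hy1⟩ := hC n
        exact hy1.trans (Finset.single_le_sum (f := fun y => ‖u n y‖)
          (fun y _ => norm_nonneg _) hy))
    simp [h0] at h2
    linarith
  refine ⟨⟨φ, hmem⟩, isEigenfunction_iff.2 ⟨fun h0 => hne ?_, E, heq⟩, ?_⟩
  · exact congrArg (fun g : Ell2 d => (g : Lattice d → ℂ)) h0
  · have hfb : ∀ y, ‖f y‖ ≤ ‖f‖ := lp.norm_apply_le_norm two_ne_zero f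
    have h1 : Tendsto (fun n => ∑' y, conj (u n y) * f y) 𝒰 (𝓝 (∑' y, conj (φ y) * f y)) := by
      refine tendsto_tsum_of_dominated_convergence
        (bound := fun y => A * Real.exp (-(c * ‖y‖)) * ‖f‖) ((hsum.mul_left A).mul_right _)
        (fun y => ((Complex.continuous_conj.tendsto _).comp (hφ y)).mul_const _)
        (Eventually.of_forall fun n y => ?_)
      rw [norm_mul, RCLike.norm_conj]
      exact mul_le_mul (hu n y) (hfb y) (norm_nonneg _) ((norm_nonneg _).trans (hu n y))
    have h2 : δ ≤ ‖∑' y, conj (φ y) * f y‖ :=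
      ge_of_tendsto h1.norm (Eventually.of_forall hδu)
    have h3 : inner ℂ (⟨φ, hmem⟩ : Ell2 d) f = ∑' y, conj (φ y) * f y := by
      rw [lp.inner_eq_tsum]
      refine tsum_congr fun y => ?_
      rw [RCLike.inner_apply, mul_comm]
    rw [h3]
    intro h0
    rw [h0, norm_zero] at h2
    linarith

/-! ### Finite-volume eigenfunctions and completeness -/

/-- An orthonormal eigenbasis of a finite restriction, extended by zero. -/
lemma exists_eigenbasis (V : Lattice d → ℝ) (s : Finset (Lattice d)) :
    ∃ (ψ : s → Lattice d → ℂ) (En : s → ℝ), (∀ j, ∀ y ∉ s, ψ j y = 0) ∧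
      (∀ j, ∀ y ∈ s, formalSchrodinger V (ψ j) y = En j * ψ j y) ∧
      (∀ y, ∑ j, ‖ψ j y‖ ^ 2 ≤ 1) ∧
      ∀ g : Lattice d → ℂ,
        (∀ y ∈ s, g y = ∑ j, (∑ w ∈ s, conj (ψ j w) * g w) * ψ j y) ∧
        ∑ j, ‖∑ w ∈ s, conj (ψ j w) * g w‖ ^ 2 = ∑ w ∈ s, ‖g w‖ ^ 2 := by
  classical
  have hH := restriction_isHermitian V s
  let B := hH.eigenvectorBasis
  let ψ : s → Lattice d → ℂ := fun j y => if h : y ∈ s then B j ⟨y, h⟩ else 0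
  have hψ : ∀ j (y : s), ψ j y = B j y := fun j y => by simp [ψ]
  have hψ0 : ∀ j, ∀ y ∉ s, ψ j y = 0 := fun j y hy => by simp [ψ, hy]
  have hinner : ∀ (g : Lattice d → ℂ) j,
      inner ℂ (B j) (WithLp.toLp 2 fun y : s => g y) = ∑ w ∈ s, conj (ψ j w) * g w := by
    intro g j
    rw [PiLp.inner_apply, ← Finset.sum_coe_sort s]
    refine Finset.sum_congr rfl fun y _ => ?_
    rw [hψ, RCLike.inner_apply, mul_comm]
  have hrep : ∀ g : Lattice d → ℂ,
        (∀ y ∈ s, g y = ∑ j, (∑ w ∈ s, conj (ψ j w) * g w) * ψ j y) ∧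
        ∑ j, ‖∑ w ∈ s, conj (ψ j w) * g w‖ ^ 2 = ∑ w ∈ s, ‖g w‖ ^ 2 := by
    intro g
    constructor
    · intro y hy
      have h1 := B.sum_repr' (WithLp.toLp 2 fun y : s => g y)
      have h2 := congrArg (fun v : EuclideanSpace ℂ s => v ⟨y, hy⟩) h1
      simp only [WithLp.ofLp_sum, Finset.sum_apply, WithLp.ofLp_smul, Pi.smul_apply,
        smul_eq_mul, hinner] at h2
      rw [← h2]
      exact Finset.sum_congr rfl fun j _ => by rw [← hψ j ⟨y, hy⟩]
    · have h1 := B.sum_sq_norm_inner_right (WithLp.toLp 2 fun y : s => g y)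
      simp only [hinner] at h1
      rw [h1, EuclideanSpace.norm_sq_eq, ← Finset.sum_coe_sort s]
  refine ⟨ψ, hH.eigenvalues, hψ0, ?_, ?_, hrep⟩
  · intro j y hy
    have h1 := congrFun (hH.mulVec_eigenvectorBasis j) ⟨y, hy⟩
    have h2 := restriction_mulVec V s (ψ j) ⟨y, hy⟩
    have h3 : (s : Set (Lattice d)).indicator (ψ j) = ψ j := by
      funext w
      by_cases hw : w ∈ s
      · simp [hw]
      · simp [hw, hψ0 j w hw]
    rw [h3, show (fun y : s => ψ j y) = (B j : s → ℂ) from funext fun y => hψ j y] at h2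
    rw [← h2]
    refine h1.trans ?_
    simp only [Pi.smul_apply, Complex.real_smul]
    rw [← hψ j ⟨y, hy⟩]
  · intro y
    by_cases hy : y ∈ s
    -- Parseval for the delta function at `y`.
    · have h1 := (hrep (Pi.single y 1)).2
      have h2 : ∀ j, ∑ w ∈ s, conj (ψ j w) * (Pi.single y (1 : ℂ) : Lattice d → ℂ) w =
          conj (ψ j y) := by
        intro j
        simp [Pi.single_apply, hy]
      have h3 : ∑ w ∈ s, ‖(Pi.single y (1 : ℂ) : Lattice d → ℂ) w‖ ^ 2 = 1 := by
        rw [Finset.sum_eq_single y]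
        · simp
        · intro w _ hw; simp [hw]
        · exact fun h => absurd hy h
      simp only [h2, h3, RCLike.norm_conj] at h1
      exact h1.le
    · simp [hψ0 _ y hy]

/-- A solution that is not too small at some `x` and for which all central boxes are resonant is
concentrated near the origin, uniformly in the size of the region. -/
lemma SparseAtAllScales.uniform_decay {V : Lattice d → ℝ} {m b : ℝ} {J : ℕ} {E : ℝ}
    {ℓ : ℕ → ℕ} (h : SparseAtAllScales V m b J E ℓ) (hd : 1 ≤ d) (hm : 0 < m) {K n : ℕ}
    (hKn : K ≤ n)
    (hres : ∀ k, K ≤ k → k ≤ n → IsResonant V m b J E (ℓ k) (centredBox d (ℓ (k + 1) / 8)))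
    {f : Lattice d → ℂ}
    (hf : ∀ y ∈ centredBox d (ℓ (n + 2)), formalSchrodinger V f y = E * f y)
    (hf1 : ∀ y, ‖f y‖ ≤ 1) (hf0 : ∀ y ∉ centredBox d (ℓ (n + 2)), f y = 0) {x : Lattice d}
    (hx : Real.exp (-(m / 192 * (ℓ (n + 2) / 4))) < ‖f x‖ * Real.exp (-(m / 192 * ‖x‖))) {a : ℝ}
    (ha : ∀ y ∈ centredBox d (ℓ (K + 1)), ‖f y‖ ≤ a) {y : Lattice d} (hy : 4 * ‖y‖ ≤ ℓ (n + 2)) :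
    ‖f y‖ ≤ a * (Real.exp (m / 32 * ℓ (K + 1)) * Real.exp (-(m / 32 * ‖y‖))) := by
  have hxS : x ∈ centredBox d (ℓ (n + 2)) := by
    by_contra hcon
    rw [hf0 x hcon, norm_zero, zero_mul] at hx
    exact absurd hx (not_lt.2 (Real.exp_pos _).le)
  -- Decay at `y` is bought with the maximum over radius `6 ‖y‖`; the weight with rate `m / 192`
  -- makes this cost `6 * (m / 192) = m / 32`, half of the available `m / 16`.
  obtain ⟨z, hzS, hz⟩ := Finset.exists_max_image (centredBox d (ℓ (n + 2)))
    (fun y => ‖f y‖ * Real.exp (-(m / 192 * ‖y‖))) ⟨x, hxS⟩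
  set W := ‖f z‖ * Real.exp (-(m / 192 * ‖z‖)) with hW
  have hW0 : 0 < W := (Real.exp_pos _).trans (hx.trans_le (hz x hxS))
  have hfW : ∀ y, ‖f y‖ ≤ W * Real.exp (m / 192 * ‖y‖) := by
    intro y
    by_cases hyS : y ∈ centredBox d (ℓ (n + 2))
    · calc ‖f y‖ = ‖f y‖ * Real.exp (-(m / 192 * ‖y‖)) * Real.exp (m / 192 * ‖y‖) := by
            rw [mul_assoc, ← Real.exp_add, neg_add_cancel, Real.exp_zero, mul_one]
        _ ≤ _ := by gcongr; exact hz y hyS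
    · rw [hf0 y hyS, norm_zero]
      positivity
  have hdec : ∀ y, ℓ (K + 1) ≤ 4 * ‖y‖ → 4 * ‖y‖ ≤ ℓ (n + 2) →
      ‖f y‖ ≤ W * Real.exp (-(m / 32 * ‖y‖)) := by
    intro y hy1 hy2
    refine (h.norm_apply_le_exp_of_forall hd hm.le hres hf hy1 hy2 hKn
      (M := W * Real.exp (m / 192 * (6 * ‖y‖))) (by positivity) fun y' hy' => ?_).trans ?_
    · refine (hfW y').trans ?_
      gcongr
    · rw [mul_left_comm, ← Real.exp_add]
      refine le_of_eq ?_
      ring_nf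
  have hℓ : (1 : ℝ) ≤ ℓ (K + 1) := by
    have := le_scale h.scales (K + 1)
    exact_mod_cast (show 1 ≤ ℓ (K + 1) by omega)
  -- The weighted maximum sits near the origin: in the decay range it would be smaller than itself,
  -- and farther out `‖f‖ ≤ 1` would put it below the weighted value at `x`.
  have hzK : 4 * ‖z‖ < ℓ (K + 1) := by
    by_contra hcon
    push Not at hcon
    rcases le_or_gt (4 * ‖z‖) (ℓ (n + 2)) with h1 | h1
    · have h2 := hdec z hcon h1
      have h3 : W ≤ W * Real.exp (-(m / 32 * ‖z‖)) * Real.exp (-(m / 192 * ‖z‖)) := by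
        conv_lhs => rw [hW]
        gcongr
      rw [mul_assoc, ← Real.exp_add] at h3
      have h4 : Real.exp (-(m / 32 * ‖z‖) + -(m / 192 * ‖z‖)) < 1 := by
        rw [← Real.exp_zero, Real.exp_lt_exp]
        have : 0 < ‖z‖ := by linarith
        have : 0 < m * ‖z‖ := by positivity
        linarith
      nlinarith
    · have h2 : W ≤ Real.exp (-(m / 192 * (ℓ (n + 2) / 4))) := by
        calc W ≤ 1 * Real.exp (-(m / 192 * ‖z‖)) := by rw [hW]; gcongr; exact hf1 z
          _ ≤ _ := by
            rw [one_mul]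
            gcongr
            linarith
      exact absurd (hx.trans_le (hz x hxS)) (not_lt.2 h2)
  have hWa : W ≤ a := by
    refine le_trans ?_ (ha z (mem_centredBox_iff_norm_le.2 (by linarith [norm_nonneg z])))
    refine mul_le_of_le_one_right (norm_nonneg _) (Real.exp_le_one_iff.2 ?_)
    rw [neg_nonpos]
    positivity
  have ha0 : 0 ≤ a := hW0.le.trans hWa
  rcases le_total (ℓ (K + 1) : ℝ) (4 * ‖y‖) with h1 | h1
  · refine (hdec y h1 hy).trans ?_
    gcongr
    refine le_mul_of_one_le_left (Real.exp_pos _).le (Real.one_le_exp (by positivity))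
  · refine (ha y (mem_centredBox_iff_norm_le.2 (by linarith [norm_nonneg y]))).trans ?_
    refine le_mul_of_one_le_right ha0 ?_
    rw [← Real.exp_add]
    refine Real.one_le_exp ?_
    have : m * ‖y‖ ≤ m * ℓ (K + 1) := by
      gcongr
      linarith [norm_nonneg y]
    linarith

lemma card_centredBox_le (L : ℕ) : ((centredBox d L).card : ℝ) ≤ (2 * (L : ℝ) + 1) ^ d :=
  card_box_le fun j => by ring_nf; exact le_rfl

/-- Extracted from the last clause of `exists_rate`, whose other factors are at least `1`. -/
lemma GoodScales.bondBound_le_exp (hd : 1 ≤ d) {m b : ℝ} {J L L' : ℕ} (hm : 0 ≤ m)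
    (h : GoodScales d m b J L L') : bondBound d L' ≤ Real.exp (m * L) := by
  obtain ⟨α, -, -, -, h1⟩ := h.exists_rate
  have hη1 : 1 ≤ resBound m b J L := Real.one_le_exp (by positivity)
  have hP1 := one_le_bondBound hd L'
  refine le_trans (le_mul_of_one_le_left (by linarith) ?_) h1
  exact one_le_mul_of_one_le_of_one_le hη1
    (one_le_pow₀ (one_le_mul_of_one_le_of_one_le hη1 hP1))

lemma GoodScales.card_centredBox_le_exp (hd : 1 ≤ d) {m b : ℝ} {J L L' : ℕ} (hm : 0 ≤ m)
    (h : GoodScales d m b J L L') : ((centredBox d L').card : ℝ) ≤ Real.exp (m * L) := by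
  refine (card_centredBox_le L').trans (le_trans ?_ (h.bondBound_le_exp hd hm))
  have h1 : (1 : ℝ) ≤ d := by exact_mod_cast hd
  exact le_mul_of_one_le_left (by positivity) (by linarith)

/-- The eigenfunctions for whose eigenvalues the central box is non-resonant have little total weight
near the origin. -/
lemma sum_norm_sq_le_of_not_isResonant (hd : 1 ≤ d) {V : Lattice d → ℝ} {m b : ℝ} {J : ℕ}
    {ℓ : ℕ → ℕ} (hm : 0 ≤ m) (h : ∀ E : ℝ, SparseAtAllScales V m b J E ℓ) {k : ℕ} {ι : Type*}
    (T : Finset ι) {ψ : ι → Lattice d → ℂ} {En : ι → ℝ}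
    (hψ : ∀ j ∈ T, ∀ y ∈ centredBox d (ℓ (k + 1)), formalSchrodinger V (ψ j) y = En j * ψ j y)
    (hψ1 : ∀ y, ∑ j ∈ T, ‖ψ j y‖ ^ 2 ≤ 1)
    (hres : ∀ j ∈ T, ¬ IsResonant V m b J (En j) (ℓ k) (centredBox d (ℓ (k + 1) / 8)))
    {x : Lattice d} (hx : ∀ j, 32 * |x j| ≤ ℓ (k + 1)) :
    ∑ j ∈ T, ‖ψ j x‖ ^ 2 ≤ Real.exp (-(m * k)) := by
  have hg := (h 0).scales k
  have hj : ∀ j ∈ T, ‖ψ j x‖ ^ 2 ≤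
      Real.exp (-(m * ℓ k)) ^ 2 * ∑ y ∈ centredBox d (ℓ (k + 1)), ‖ψ j y‖ ^ 2 := by
    intro j hj
    have h1 := (h (En j)).norm_apply_le_of_not_isResonant hd hm (hres j hj) (hψ j hj) hx
      (M := √(∑ y ∈ centredBox d (ℓ (k + 1)), ‖ψ j y‖ ^ 2)) (Real.sqrt_nonneg _)
      (fun y hy => Real.le_sqrt_of_sq_le
        (Finset.single_le_sum (f := fun y => ‖ψ j y‖ ^ 2) (fun y _ => by positivity) hy))
    calc ‖ψ j x‖ ^ 2 ≤
          (Real.exp (-(m * ℓ k)) * √(∑ y ∈ centredBox d (ℓ (k + 1)), ‖ψ j y‖ ^ 2)) ^ 2 := by gcongr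
      _ = _ := by
        rw [mul_pow, Real.sq_sqrt (Finset.sum_nonneg fun y _ => by positivity)]
  calc ∑ j ∈ T, ‖ψ j x‖ ^ 2
      ≤ ∑ j ∈ T, Real.exp (-(m * ℓ k)) ^ 2 * ∑ y ∈ centredBox d (ℓ (k + 1)), ‖ψ j y‖ ^ 2 :=
        Finset.sum_le_sum hj
    _ = Real.exp (-(m * ℓ k)) ^ 2 * ∑ y ∈ centredBox d (ℓ (k + 1)), ∑ j ∈ T, ‖ψ j y‖ ^ 2 := by
        rw [← Finset.mul_sum, Finset.sum_comm]
    _ ≤ Real.exp (-(m * ℓ k)) ^ 2 * ∑ _y ∈ centredBox d (ℓ (k + 1)), (1 : ℝ) := by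
        gcongr with y _
        exact hψ1 y
    _ = Real.exp (-(m * ℓ k)) ^ 2 * (centredBox d (ℓ (k + 1))).card := by simp
    -- Half of the squared decay absorbs the number of points.
    _ ≤ Real.exp (-(m * ℓ k)) ^ 2 * Real.exp (m * ℓ k) := by
        gcongr
        exact hg.card_centredBox_le_exp hd hm
    _ = Real.exp (-(m * ℓ k)) := by
        rw [sq, mul_assoc, ← Real.exp_add, neg_add_cancel, Real.exp_zero, mul_one]
    _ ≤ _ := by
        have : (k : ℝ) ≤ ℓ k := by exact_mod_cast le_scale (h 0).scales k
        gcongr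

/-- Ensures that an eigenfunction with squared modulus at least `ε / (2 L + 1)^d` at a point passes
the threshold `hx` of `uniform_decay`. -/
lemma eventually_exp_lt (d : ℕ) {c B ε : ℝ} (hc : 0 < c) (hB : 0 < B) (hε : 0 < ε) :
    ∀ᶠ L : ℕ in atTop, Real.exp (-(c * (L / 4))) < √(ε / (2 * (L : ℝ) + 1) ^ d) * B := by
  have h1 := (tendsto_rpow_mul_exp_neg_mul_atTop_nhds_zero d (c / 2) (by positivity)).comp
    (tendsto_natCast_atTop_atTop (R := ℝ))
  have h2 := h1.eventually (gt_mem_nhds (show 0 < ε * B ^ 2 / 3 ^ d by positivity))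
  filter_upwards [h2, eventually_ge_atTop 1] with L hL hL1
  have hL1' : (1 : ℝ) ≤ L := by exact_mod_cast hL1
  simp only [Function.comp_apply, Real.rpow_natCast] at hL
  rw [← div_lt_iff₀ hB, Real.lt_sqrt (by positivity), lt_div_iff₀ (by positivity), div_pow,
    div_mul_eq_mul_div, div_lt_iff₀ (by positivity), ← Real.exp_nat_mul]
  rw [lt_div_iff₀ (by positivity)] at hL
  refine lt_of_le_of_lt ?_ hL
  calc Real.exp ((2 : ℕ) * -(c * (L / 4))) * (2 * (L : ℝ) + 1) ^ d
      ≤ Real.exp ((2 : ℕ) * -(c * (L / 4))) * (3 * (L : ℝ)) ^ d := by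
        gcongr
        linarith
    _ = _ := by
      rw [mul_pow, show ((2 : ℕ) : ℝ) * -(c * (L / 4)) = -(c / 2) * L by push_cast; ring]
      ring

lemma exists_sum_exp_lt {m ε : ℝ} (hm : 0 < m) (hε : 0 < ε) :
    ∃ K : ℕ, ∀ K', K ≤ K' → ∀ n, ∑ k ∈ Finset.Icc K' n, Real.exp (-(m * k)) ≤ ε := by
  have hs : Summable fun k : ℕ => Real.exp (-(m * k)) := by
    refine (Real.summable_exp_nat_mul_iff.2 (show -m < 0 by linarith)).congr fun n => ?_
    congr 1; ring
  obtain ⟨s, hs⟩ := summable_iff_vanishing_norm.1 hs ε hε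
  refine ⟨s.sup id + 1, fun K' hK' n => ?_⟩
  refine (le_abs_self _).trans (hs _ ?_).le
  rw [Finset.disjoint_left]
  intro k hk hks
  have h1 := Finset.le_sup (f := id) hks
  have h2 := (Finset.mem_Icc.1 hk).1
  simp only [id] at h1
  omega

lemma norm_single_one (i : Fin d) : ‖(Pi.single i 1 : Lattice d)‖ ≤ 1 := by
  rw [pi_norm_le_iff_of_nonneg zero_le_one]
  intro j
  by_cases hj : j = i
  · subst hj; simp
  · simp [hj]

lemma formalSchrodinger_congr {V : Lattice d → ℝ} {f g : Lattice d → ℂ} {y : Lattice d}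
    (h : ∀ w, ‖w‖ ≤ ‖y‖ + 1 → f w = g w) : formalSchrodinger V f y = formalSchrodinger V g y := by
  simp only [formalSchrodinger_apply]
  rw [h y (by linarith)]
  congr 1
  refine Finset.sum_congr rfl fun i _ => ?_
  rw [h _ ((norm_add_le _ _).trans (by linarith [norm_single_one i])),
    h _ ((norm_sub_le _ _).trans (by linarith [norm_single_one i]))]

/-- The total weight at `x` of the eigenfunctions that have a non-resonant central box at some scale,
or are small at `x`. -/
lemma sum_norm_sq_le_two_mul (hd : 1 ≤ d) {V : Lattice d → ℝ} {m b : ℝ} {J : ℕ}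
    {ℓ : ℕ → ℕ} (hm : 0 ≤ m) (h : ∀ E : ℝ, SparseAtAllScales V m b J E ℓ) {K n : ℕ} {ι : Type*}
    [Fintype ι] {ψ : ι → Lattice d → ℂ} {En : ι → ℝ}
    (hψ : ∀ j, ∀ y ∈ centredBox d (ℓ (n + 2)), formalSchrodinger V (ψ j) y = En j * ψ j y)
    (hψ1 : ∀ y, ∑ j, ‖ψ j y‖ ^ 2 ≤ 1) {x : Lattice d} (hx : ∀ j, 32 * |x j| ≤ K) {ε D : ℝ}
    (hε : 0 ≤ ε) (hD : 0 < D) (hcard : Fintype.card ι ≤ D)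
    (hK : ∑ k ∈ Finset.Icc K n, Real.exp (-(m * k)) ≤ ε) (T : Finset ι)
    (hT : ∀ j ∈ T, (∃ k ∈ Finset.Icc K n,
      ¬ IsResonant V m b J (En j) (ℓ k) (centredBox d (ℓ (k + 1) / 8))) ∨ ‖ψ j x‖ ^ 2 ≤ ε / D) :
    ∑ j ∈ T, ‖ψ j x‖ ^ 2 ≤ 2 * ε := by
  classical
  let U : ℕ → Finset ι := fun k => Finset.univ.filter fun j =>
    ¬ IsResonant V m b J (En j) (ℓ k) (centredBox d (ℓ (k + 1) / 8))
  have hUk : ∀ k ∈ Finset.Icc K n, ∑ j ∈ U k, ‖ψ j x‖ ^ 2 ≤ Real.exp (-(m * k)) := by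
    intro k hk
    rw [Finset.mem_Icc] at hk
    refine sum_norm_sq_le_of_not_isResonant hd hm h (U k) (fun j _ y hy => hψ j y ?_)
      (fun y => (Finset.sum_le_sum_of_subset_of_nonneg (Finset.subset_univ _)
        fun j _ _ => by positivity).trans (hψ1 y))
      (fun j hj => (Finset.mem_filter.1 hj).2) (fun j => ?_)
    · rw [mem_centredBox_iff_norm_le] at hy ⊢
      have : ℓ (k + 1) ≤ ℓ (n + 2) := monotone_scale (h 0).scales (by omega)
      exact hy.trans (by exact_mod_cast this)
    · have h2 := hx j
      have h3 := le_scale (h 0).scales (k + 1)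
      omega
  have hpt : ∀ j ∈ T, ‖ψ j x‖ ^ 2 ≤
      (∑ k ∈ Finset.Icc K n, if j ∈ U k then ‖ψ j x‖ ^ 2 else 0) + ε / D := by
    intro j hj
    have h0 : ∀ k ∈ Finset.Icc K n, 0 ≤ if j ∈ U k then ‖ψ j x‖ ^ 2 else 0 :=
      fun k _ => by split_ifs <;> positivity
    rcases hT j hj with ⟨k, hk, hk'⟩ | h2
    · have hjU : j ∈ U k := Finset.mem_filter.2 ⟨Finset.mem_univ _, hk'⟩
      have h2 := Finset.single_le_sum h0 hk
      rw [if_pos hjU] at h2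
      have h3 : 0 ≤ ε / D := by positivity
      linarith
    · linarith [Finset.sum_nonneg h0]
  calc ∑ j ∈ T, ‖ψ j x‖ ^ 2
      ≤ ∑ j ∈ T, ((∑ k ∈ Finset.Icc K n, if j ∈ U k then ‖ψ j x‖ ^ 2 else 0) + ε / D) :=
        Finset.sum_le_sum hpt
    _ ≤ ∑ j, ((∑ k ∈ Finset.Icc K n, if j ∈ U k then ‖ψ j x‖ ^ 2 else 0) + ε / D) := by
        refine Finset.sum_le_sum_of_subset_of_nonneg (Finset.subset_univ _) fun j _ _ => ?_
        exact add_nonneg (Finset.sum_nonneg fun k _ => by split_ifs <;> positivity)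
          (by positivity)
    _ = ∑ k ∈ Finset.Icc K n, ∑ j ∈ U k, ‖ψ j x‖ ^ 2 + Fintype.card ι * (ε / D) := by
        rw [Finset.sum_add_distrib, Finset.sum_comm]
        congr 1
        · refine Finset.sum_congr rfl fun k _ => ?_
          rw [← Finset.sum_filter, Finset.filter_univ_mem]
        · simp
    _ ≤ ε + D * (ε / D) := by
        gcongr
        exact (Finset.sum_le_sum hUk).trans hK
    _ = 2 * ε := by
        rw [mul_div_cancel₀ _ hD.ne']
        ring

/-- The overlap of `f` with a localized solution, cut off to a box, is small if `f` is nearly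
orthogonal to all normalized localized approximate solutions. -/
lemma norm_overlap_le {V : Lattice d → ℝ} {f : Lattice d → ℂ} {A c δ a E : ℝ} {C R N L : ℕ}
    (hA : 0 ≤ A) (hR : ∀ (u : Lattice d → ℂ) (E : ℝ),
      (∀ y, ‖u y‖ ≤ A * Real.exp (-(c * ‖y‖))) →
      (∀ y ∈ centredBox d R, formalSchrodinger V u y = E * u y) →
      (∃ y ∈ centredBox d C, 1 ≤ ‖u y‖) → ‖∑' y, conj (u y) * f y‖ < δ)
    (hCN : C ≤ N) (hRN : R + 1 ≤ N) (hNL : N ≤ L) {ψ : Lattice d → ℂ}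
    (hψ : ∀ y ∈ centredBox d L, formalSchrodinger V ψ y = E * ψ y) (ha : 0 < a)
    (hdec : ∀ y ∈ centredBox d N, ‖ψ y‖ ≤ a * (A * Real.exp (-(c * ‖y‖)))) {y₀ : Lattice d}
    (hy₀ : y₀ ∈ centredBox d C) (hay₀ : a ≤ ‖ψ y₀‖) :
    ‖∑ w ∈ centredBox d L, conj (ψ w) * if w ∈ centredBox d N then f w else 0‖ ≤ a * δ := by
  have hsub : ∀ {M M' : ℕ}, M ≤ M' → centredBox d M ⊆ centredBox d M' := by
    intro M M' hM y hy
    rw [mem_centredBox_iff_norm_le] at hy ⊢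
    exact hy.trans (by exact_mod_cast hM)
  have hnorm : ‖(a : ℂ)⁻¹‖ = a⁻¹ := by
    rw [norm_inv, Complex.norm_real, Real.norm_eq_abs, abs_of_pos ha]
  -- Normalized by `a` and cut off to the box of size `N`, `ψ` meets the requirements of `hR`; `R +
  -- 1 ≤ N` keeps the cut away from the equation on the box of size `R`.
  let u : Lattice d → ℂ := fun y => if y ∈ centredBox d N then (a : ℂ)⁻¹ * ψ y else 0
  have hu : ∀ y ∈ centredBox d N, u y = (a : ℂ)⁻¹ * ψ y := fun y hy => if_pos hy
  have hu1 : ∀ y, ‖u y‖ ≤ A * Real.exp (-(c * ‖y‖)) := by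
    intro y
    by_cases hy : y ∈ centredBox d N
    · rw [hu y hy, norm_mul, hnorm, inv_mul_le_iff₀ ha]
      exact hdec y hy
    · simp only [u, if_neg hy, norm_zero]
      positivity
  have hu2 : ∀ y ∈ centredBox d R, formalSchrodinger V u y = E * u y := by
    intro y hy
    have hyL : y ∈ centredBox d L := hsub (by omega) hy
    rw [mem_centredBox_iff_norm_le] at hy
    have hRN' : (R : ℝ) + 1 ≤ N := by exact_mod_cast hRN
    have hcongr : ∀ w, ‖w‖ ≤ ‖y‖ + 1 → u w = ((a : ℂ)⁻¹ • ψ) w := fun w hw =>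
      hu w (mem_centredBox_iff_norm_le.2 (by linarith))
    rw [formalSchrodinger_congr hcongr, map_smul, Pi.smul_apply, hψ y hyL,
      hcongr y (by linarith), Pi.smul_apply, smul_eq_mul, smul_eq_mul]
    ring
  have hu3 : 1 ≤ ‖u y₀‖ := by
    rw [hu y₀ (hsub hCN hy₀), norm_mul, hnorm, le_inv_mul_iff₀ ha, mul_one]
    exact hay₀
  have hu4 : ∑' y, conj (u y) * f y = (a : ℂ)⁻¹ *
      ∑ w ∈ centredBox d L, conj (ψ w) * if w ∈ centredBox d N then f w else 0 := by
    rw [tsum_eq_sum (s := centredBox d L)]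
    · rw [Finset.mul_sum]
      refine Finset.sum_congr rfl fun y _ => ?_
      by_cases hy : y ∈ centredBox d N
      · rw [hu y hy, if_pos hy, map_mul, map_inv₀, Complex.conj_ofReal]
        ring
      · simp [u, hy]
    · intro y hy
      have : y ∉ centredBox d N := fun hy' => hy (hsub hNL hy')
      simp [u, this]
  have h5 := hR u E hu1 hu2 ⟨y₀, hy₀, hu3⟩
  rw [hu4, norm_mul, hnorm, inv_mul_lt_iff₀ ha] at h5
  exact h5.le

/-- The two terms come from the two kinds of finite-volume eigenfunctions: Cauchy–Schwarz and small
weight at `x` for the non-localized or negligible ones, small overlap with `f` for the localized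
ones. -/
lemma norm_apply_le_of_orthogonal (hd : 1 ≤ d) {V : Lattice d → ℝ} {m b : ℝ} {J : ℕ} {ℓ : ℕ → ℕ}
    (hm : 0 < m) (h : ∀ E : ℝ, SparseAtAllScales V m b J E ℓ) {f : Ell2 d}
    (hf : ∀ ψ, IsEigenfunction (schrodinger V) ψ → inner ℂ ψ f = 0) (x : Lattice d) {ε : ℝ}
    (hε : 0 < ε) : ‖f x‖ ≤ √(2 * ε) * ‖f‖ + ε := by
  classical
  have hscales := (h 0).scales
  have hmono := monotone_scale hscales
  obtain ⟨K₀, hK₀⟩ := exists_sum_exp_lt hm hε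
  obtain ⟨i₀, r, hi₀, hr, hxr⟩ := exists_norm_eq hd x
  set K := max K₀ (32 * r)
  set C := ℓ (K + 1)
  have hrK : 32 * r ≤ K := le_max_right _ _
  have hKC : K + 1 ≤ C := le_scale hscales _
  have hxC : x ∈ centredBox d C := mem_centredBox.2 fun j => by have := hi₀ j; omega
  have hcardC : (0 : ℝ) < (centredBox d C).card := by
    exact_mod_cast Finset.card_pos.2 ⟨x, hxC⟩
  obtain ⟨δ, hδ0, hδ⟩ : ∃ δ : ℝ, 0 < δ ∧ δ * (centredBox d C).card = ε :=
    ⟨ε / (centredBox d C).card, by positivity, by field_simp⟩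
  -- Compactness: failure for every `R` would produce an eigenfunction not orthogonal to `f`.
  obtain ⟨R, hR⟩ : ∃ R : ℕ, ∀ (u : Lattice d → ℂ) (E : ℝ),
      (∀ y, ‖u y‖ ≤ Real.exp (m / 32 * C) * Real.exp (-(m / 32 * ‖y‖))) →
      (∀ y ∈ centredBox d R, formalSchrodinger V u y = E * u y) →
      (∃ y ∈ centredBox d C, 1 ≤ ‖u y‖) → ‖∑' y, conj (u y) * f y‖ < δ := by
    by_contra hcon
    push Not at hcon
    obtain ⟨ψ, hψ, hψf⟩ := exists_eigenfunction_of_approximate hd (V := V) (f := f)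
      (show 0 < m / 32 by positivity) hδ0 hcon
    exact hψf (hf ψ hψ)
  have hℓlim : Tendsto (fun n => ℓ (n + 2)) atTop atTop :=
    tendsto_atTop_mono (fun n => (Nat.le_add_right n 2).trans (le_scale hscales (n + 2))) tendsto_id
  obtain ⟨n, hn1, hn2, hKn⟩ := ((hℓlim.eventually (eventually_exp_lt d
    (show 0 < m / 192 by positivity) (Real.exp_pos (-(m / 192 * ‖x‖))) hε)).and
      ((hℓlim.eventually (eventually_ge_atTop (4 * (R + 1)))).and (eventually_ge_atTop K))).exists
  set L := ℓ (n + 2)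
  have hCL : C ≤ L := hmono (by omega)
  obtain ⟨ψ, En, hψ0, hψE, hψ1, hrep⟩ := exists_eigenbasis V (centredBox d L)
  have hψ1' : ∀ j y, ‖ψ j y‖ ≤ 1 := by
    intro j y
    have h1 := (Finset.single_le_sum (f := fun j => ‖ψ j y‖ ^ 2) (fun j _ => by positivity)
      (Finset.mem_univ j)).trans (hψ1 y)
    simpa using h1
  have hN4 : ∀ y ∈ centredBox d (L / 4), 4 * ‖y‖ ≤ L := by
    intro y hy
    have h1 := mem_centredBox_iff_norm_le.1 hy
    have h2 : 4 * ((L / 4 : ℕ) : ℝ) ≤ L := by exact_mod_cast Nat.mul_div_le L 4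
    linarith
  have hCN : C ≤ L / 4 := by
    have h1 : C ≤ ℓ (n + 1) := hmono (by omega)
    have h2 : 1000 * (J + 1) * ℓ (n + 1) ≤ L := (hscales (n + 1)).mul_le
    have h3 : 1000 * ℓ (n + 1) ≤ 1000 * (J + 1) * ℓ (n + 1) := by gcongr; omega
    omega
  have hxN : x ∈ centredBox d (L / 4) := mem_centredBox.2 fun j => by have := hi₀ j; omega
  have hxL : x ∈ centredBox d L := mem_centredBox.2 fun j => by have := hi₀ j; omega
  -- The cut-off at `L / 4` matches the range in which `uniform_decay` controls the eigenfunctions.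
  let g : Lattice d → ℂ := fun y => if y ∈ centredBox d (L / 4) then f y else 0
  obtain ⟨hg1, hg2⟩ := hrep g
  obtain ⟨p, hp⟩ : ∃ p : centredBox d L → ℂ, p = fun j =>
    ∑ w ∈ centredBox d L, conj (ψ j w) * g w := ⟨_, rfl⟩
  have hfx : f x = ∑ j, p j * ψ j x := by
    have h1 := hg1 x hxL
    rw [show g x = f x from if_pos hxN] at h1
    rw [h1, hp]
  -- The threshold is `ε` over a bound for the number of eigenfunctions, so those below it weigh at
  -- most `ε` in total at `x`.
  let good : Finset (centredBox d L) := Finset.univ.filter fun j =>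
    (∀ k, K ≤ k → k ≤ n → IsResonant V m b J (En j) (ℓ k) (centredBox d (ℓ (k + 1) / 8))) ∧
      ε / (2 * (L : ℝ) + 1) ^ d ≤ ‖ψ j x‖ ^ 2
  -- the contribution of the localized eigenfunctions
  have hgood : ∀ j ∈ good, ‖p j‖ * ‖ψ j x‖ ≤ δ * ∑ y ∈ centredBox d C, ‖ψ j y‖ ^ 2 := by
    intro j hj
    obtain ⟨hjres, hjx⟩ := (Finset.mem_filter.1 hj).2
    obtain ⟨y₀, hy₀, hmax⟩ := Finset.exists_max_image (centredBox d C) (fun y => ‖ψ j y‖) ⟨x, hxC⟩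
    set a := ‖ψ j y₀‖
    have hxa : ‖ψ j x‖ ≤ a := hmax x hxC
    have hx0 : 0 < ‖ψ j x‖ := by
      have : 0 < ‖ψ j x‖ ^ 2 := lt_of_lt_of_le (by positivity) hjx
      exact (norm_nonneg _).lt_of_ne' fun h0 => by simp [h0] at this
    have ha0 : 0 < a := hx0.trans_le hxa
    have hsmall : Real.exp (-(m / 192 * (L / 4))) <
        ‖ψ j x‖ * Real.exp (-(m / 192 * ‖x‖)) := by
      refine hn1.trans_le ?_
      gcongr
      exact Real.sqrt_le_iff.2 ⟨norm_nonneg _, hjx⟩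
    have h5 : ‖p j‖ ≤ a * δ := by
      rw [hp]
      exact norm_overlap_le (Real.exp_pos _).le hR hCN (by omega) (Nat.div_le_self L 4) (hψE j) ha0
        (fun y hy => (h (En j)).uniform_decay hd hm hKn hjres (hψE j) (hψ1' j) (hψ0 j) hsmall hmax
          (hN4 y hy)) hy₀ le_rfl
    calc ‖p j‖ * ‖ψ j x‖ ≤ a * δ * a := by gcongr
      _ = δ * a ^ 2 := by ring
      _ ≤ _ := by
        gcongr
        exact Finset.single_le_sum (f := fun y => ‖ψ j y‖ ^ 2) (fun y _ => by positivity) hy₀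
  have hgoodsum : ∑ j ∈ good, ‖p j‖ * ‖ψ j x‖ ≤ ε := by
    calc ∑ j ∈ good, ‖p j‖ * ‖ψ j x‖ ≤ ∑ j ∈ good, δ * ∑ y ∈ centredBox d C, ‖ψ j y‖ ^ 2 :=
          Finset.sum_le_sum hgood
      _ ≤ ∑ j, δ * ∑ y ∈ centredBox d C, ‖ψ j y‖ ^ 2 :=
          Finset.sum_le_sum_of_subset_of_nonneg (Finset.subset_univ _) fun j _ _ => by positivity
      _ = δ * ∑ y ∈ centredBox d C, ∑ j, ‖ψ j y‖ ^ 2 := by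
          rw [← Finset.mul_sum, Finset.sum_comm]
      _ ≤ δ * ∑ _y ∈ centredBox d C, (1 : ℝ) := by
          gcongr with y _
          exact hψ1 y
      _ = ε := by
          rw [Finset.sum_const, nsmul_eq_mul, mul_one, hδ]
  -- the weight of the other eigenfunctions
  have hbadsum : ∑ j ∈ goodᶜ, ‖ψ j x‖ ^ 2 ≤ 2 * ε := by
    refine sum_norm_sq_le_two_mul hd hm.le h hψE hψ1 (K := K) (n := n)
      (D := (2 * (L : ℝ) + 1) ^ d) (fun j => by have := hi₀ j; omega) hε.le (by positivity) ?_
      (hK₀ K (le_max_left _ _) n) _ fun j hj => ?_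
    · rw [Fintype.card_coe]
      exact card_centredBox_le L
    · by_contra hcon
      push Not at hcon
      refine Finset.mem_compl.1 hj (Finset.mem_filter.2 ⟨Finset.mem_univ _, fun k hk1 hk2 => ?_,
        hcon.2.le⟩)
      exact hcon.1 k (Finset.mem_Icc.2 ⟨hk1, hk2⟩)
  have hpsum : ∑ j ∈ goodᶜ, ‖p j‖ ^ 2 ≤ ‖f‖ ^ 2 := by
    calc ∑ j ∈ goodᶜ, ‖p j‖ ^ 2 ≤ ∑ j, ‖p j‖ ^ 2 :=
          Finset.sum_le_sum_of_subset_of_nonneg (Finset.subset_univ _) fun j _ _ => by positivity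
      _ = ∑ w ∈ centredBox d L, ‖g w‖ ^ 2 := by rw [← hg2, hp]
      _ ≤ ∑ w ∈ centredBox d L, ‖f w‖ ^ 2 := by
          refine Finset.sum_le_sum fun w _ => ?_
          by_cases hw : w ∈ centredBox d (L / 4)
          · simp [g, hw]
          · simp [g, hw]
      _ ≤ ‖f‖ ^ 2 := by
          have := lp.sum_rpow_le_norm_rpow (p := 2) (by norm_num) f (centredBox d L)
          simpa using this
  calc ‖f x‖ = ‖∑ j, p j * ψ j x‖ := by rw [hfx]
    _ ≤ ∑ j, ‖p j‖ * ‖ψ j x‖ := (norm_sum_le _ _).trans (le_of_eq (by simp))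
    _ = ∑ j ∈ goodᶜ, ‖p j‖ * ‖ψ j x‖ + ∑ j ∈ good, ‖p j‖ * ‖ψ j x‖ :=
        (Finset.sum_compl_add_sum _ _).symm
    _ ≤ √(∑ j ∈ goodᶜ, ‖p j‖ ^ 2) * √(∑ j ∈ goodᶜ, ‖ψ j x‖ ^ 2) + ε :=
        add_le_add (Real.sum_mul_le_sqrt_mul_sqrt _ _ _) hgoodsum
    _ ≤ √(‖f‖ ^ 2) * √(2 * ε) + ε := by gcongr
    _ = √(2 * ε) * ‖f‖ + ε := by rw [Real.sqrt_sq (norm_nonneg _), mul_comm]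

lemma hasPurePointSpectrum (hd : 1 ≤ d) {V : Lattice d → ℝ} {m b : ℝ} {J : ℕ} {ℓ : ℕ → ℕ}
    (hm : 0 < m) (h : ∀ E : ℝ, SparseAtAllScales V m b J E ℓ) :
    HasPurePointSpectrum (schrodinger V) := by
  unfold HasPurePointSpectrum
  rw [Submodule.topologicalClosure_eq_top_iff, Submodule.eq_bot_iff]
  intro f hf
  rw [Submodule.mem_orthogonal] at hf
  refine lp.ext (funext fun x => ?_)
  have h1 : ∀ ε : ℝ, 0 < ε → ‖f x‖ ≤ √(2 * ε) * ‖f‖ + ε := fun ε hε =>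
    norm_apply_le_of_orthogonal hd hm h (fun ψ hψ => hf ψ (Submodule.subset_span hψ)) x hε
  have h2 : Tendsto (fun ε : ℝ => √(2 * ε) * ‖f‖ + ε) (𝓝[>] 0) (𝓝 0) := by
    have h3 : Continuous fun ε : ℝ => √(2 * ε) * ‖f‖ + ε := by fun_prop
    have h4 := h3.tendsto 0
    simp only [mul_zero, Real.sqrt_zero, zero_mul, add_zero] at h4
    exact h4.mono_left nhdsWithin_le_nhds
  have h3 : ‖f x‖ ≤ 0 := ge_of_tendsto h2 (by
    filter_upwards [self_mem_nhdsWithin] with ε hε using h1 ε hε)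
  exact norm_le_zero_iff.1 h3

end

end MSA

theorem proposition3 (d : ℕ) (hd : 1 ≤ d) (m b γ : ℝ) (J : ℕ)
    (hm : 0 < m) (hb0 : 0 < b) (hb1 : b < 1) (hγ : 2 - b < γ) (hJ : 1 ≤ J) :
    ∃ Lstar : ℕ, ∀ L₀ : ℕ, Lstar ≤ L₀ → ∀ V : MSA.Lattice d → ℝ,
      (∀ E : ℝ,
        (∀ k : ℕ,
          (∀ R : Finset (MSA.Lattice d), MSA.IsRectangle (MSA.scale γ L₀ (k + 2)) R →
            MSA.IsSparse J
              (MSA.resonantRectangles V m b J E (MSA.scale γ L₀ k) (MSA.scale γ L₀ (k + 1))) R) ∧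
          MSA.IsSparse 2
            (MSA.resonantRectangles V m b J E (MSA.scale γ L₀ k) (MSA.scale γ L₀ (k + 1)))
            (MSA.centredBox d (MSA.scale γ L₀ (k + 2)))) ∧
        (∀ R : Finset (MSA.Lattice d), MSA.IsRectangle (MSA.scale γ L₀ 1) R →
          MSA.IsSparse J (MSA.singularRectangles V m b E (MSA.scale γ L₀ 0)) R)) →
      MSA.HasPurePointSpectrum (MSA.schrodinger V) ∧
      ∀ ψ : MSA.Ell2 d, MSA.IsEigenfunction (MSA.schrodinger V) ψ →
        ∃ C : ℝ, ∀ x : MSA.Lattice d, ‖ψ x‖ * Real.exp (m / 16 * ‖x‖) ≤ C := by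
  obtain ⟨N, hN⟩ := Filter.eventually_atTop.1 (MSA.eventually_goodScales hd hm hb0 hb1 hγ hJ)
  refine ⟨N, fun L₀ hL₀ V hV => ?_⟩
  -- The scales never decrease, so all of them stay above the threshold.
  have hge : ∀ k, N ≤ MSA.scale γ L₀ k := by
    intro k
    induction k with
    | zero => exact hL₀
    | succ k ih => exact ih.trans (hN _ ih).le
  have hsp : ∀ E : ℝ, MSA.SparseAtAllScales V m b J E (MSA.scale γ L₀) := fun E =>
    MSA.sparseAtAllScales hd hm.le (fun k => hN _ (hge k)) (fun k => ((hV E).1 k).1)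
      (fun k => ((hV E).1 k).2) (hV E).2
  exact ⟨MSA.hasPurePointSpectrum hd hm hsp,
    fun ψ hψ => MSA.exponential_localization hd hm hsp hψ⟩
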